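/- Let $s$ and $p$ be fixed positive integers. Consider the following optimization problem (F$'$). An instance consists of positive integers $n_1,\dots,n_s$, a family $\mathcal I'$ of $p$ nonempty subsets of $[s]=\{1,\dots,s\}$ (an indexed family: the same subset may occur several times), and, for every member $I$ of $\mathcal I'$ and every $j\in I$, a vector $c^{I,j}\in\mathbb Q^{n_j}$ and a scalar $d^{I,j}\in\mathbb Q$. The task is to find an optimal solution $(x^1,\dots,x^s)$ of $$\max_{x^1,\dots,x^s}\ \sum_{I\in\mathcal I'}\ \prod_{j\in I}\bigl(\langle c^{I,j},x^j\rangle+d^{I,j}\bigr)\qquad\text{subject to } x^j\in\{0,1\}^{n_j}\ \ \forall j\in[s].$$ For any fixed $s$ and $p=|\mathcal I'|$, this problem can be solved in strongly polynomial time. That is, for every $s,p\ge 1$ there are a program (for a random access machine that performs additions, subtractions, multiplications, divisions and comparisons of rational numbers in one step each, and that uses integers only for control and addressing) and polynomials $T,S$ such that, on every instance with parameters $s,p$, the program halts with an optimal solution after at most $T(N)$ steps, where $N$ is the number of variables plus the number of rational coefficients of the instance; all control and address integers that it writes are at most $T(N)$; and every rational number produced during the execution has size (binary encoding length) at most $S(L)$,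 where $L$ is $N$ plus the total size of the rational coefficients of the instance. -/

import Mathlib

/-! ### A random access machine over the rationals

The standard arithmetic model for strongly polynomial algorithms.  Natural numbers are used for
control and addressing only; rational data can be added, subtracted, multiplied, divided, copied and
compared, and influence the control flow only through comparisons.  Each of these operations is one
step. -/

/-- The memory: integer registers, integer arrays, and arrays of rational numbers. In each of the
three, the first argument is the name of the register or array (fixed in the program text);
array cells are addressed by natural numbers. -/
structure RamState where
  reg : ℕ → ℕ
  iarr : ℕ → ℕ → ℕ
  arr : ℕ → ℕ → ℚ

/-- A reference to a cell of a rational array: the name of the array, and the name of the integer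
register which holds the address of the cell. -/
structure RatCell where
  array : ℕ
  index : ℕ

inductive IntOp
  | add
  | sub
  | mul

/-- Subtraction of natural numbers is truncated. -/
def IntOp.eval : IntOp → ℕ → ℕ → ℕ
  | .add, a, b => a + b
  | .sub, a, b => a - b
  | .mul, a, b => a * b

inductive RatOp
  | add
  | sub
  | mul
  | div

/-- Division by zero returns zero; a program can test for it by a comparison. -/
def RatOp.eval : RatOp → ℚ → ℚ → ℚ
  | .add, a, b => a + b
  | .sub, a, b => a - b
  | .mul, a, b => a * b
  | .div, a, b => a / b

/-- Elementary instructions. The destination comes first. -/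
inductive RamInstr
  | const (r k : ℕ)
  | intOp (o : IntOp) (r a b : ℕ)
  | load (r a i : ℕ)
  | store (a i r : ℕ)
  | ratConst (d : RatCell) (q : ℚ)
  | ratCopy (d x : RatCell)
  | ratOp (o : RatOp) (d x y : RatCell)

/-- Tests: strict comparison of two integer registers, or of two rational cells. -/
inductive RamTest
  | intLt (a b : ℕ)
  | ratLt (x y : RatCell)

/-- Programs. -/
inductive RamProg
  | instr (i : RamInstr)
  | seq (p q : RamProg)
  | ite (b : RamTest) (p q : RamProg)
  | while (b : RamTest) (p : RamProg)

namespace RamState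

def read (σ : RamState) (x : RatCell) : ℚ := σ.arr x.array (σ.reg x.index)

def setReg (σ : RamState) (r v : ℕ) : RamState :=
  { σ with reg := Function.update σ.reg r v }

def setInt (σ : RamState) (a i v : ℕ) : RamState :=
  { σ with iarr := Function.update σ.iarr a (Function.update (σ.iarr a) i v) }

def write (σ : RamState) (d : RatCell) (q : ℚ) : RamState :=
  { σ with
    arr := Function.update σ.arr d.array (Function.update (σ.arr d.array) (σ.reg d.index) q) }

end RamState

/-- The size (binary encoding length) of a rational number in lowest terms: the number of binary
digits of the absolute value of the numerator and of the denominator, and one bit for the sign. -/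
def ratSize (q : ℚ) : ℕ := 1 + Nat.size q.num.natAbs + Nat.size q.den

/-- The effect of an instruction. -/
def RamInstr.run (σ : RamState) : RamInstr → RamState
  | .const r k => σ.setReg r k
  | .intOp o r a b => σ.setReg r (o.eval (σ.reg a) (σ.reg b))
  | .load r a i => σ.setReg r (σ.iarr a (σ.reg i))
  | .store a i r => σ.setInt a (σ.reg i) (σ.reg r)
  | .ratConst d q => σ.write d q
  | .ratCopy d x => σ.write d (σ.read x)
  | .ratOp o d x y => σ.write d (o.eval (σ.read x) (σ.read y))

/-- The number written by the instruction is at most `W` if it is an integer, and has size at most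
`B` if it is a rational. -/
def RamInstr.Fits (W B : ℕ) (σ : RamState) : RamInstr → Prop
  | .const _ k => k ≤ W
  | .intOp o _ a b => o.eval (σ.reg a) (σ.reg b) ≤ W
  | .load _ a i => σ.iarr a (σ.reg i) ≤ W
  | .store _ _ r => σ.reg r ≤ W
  | .ratConst _ q => ratSize q ≤ B
  | .ratCopy _ x => ratSize (σ.read x) ≤ B
  | .ratOp o _ x y => ratSize (o.eval (σ.read x) (σ.read y)) ≤ B

def RamTest.Holds (σ : RamState) : RamTest → Prop
  | .intLt a b => σ.reg a < σ.reg b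
  | .ratLt x y => σ.read x < σ.read y

/-- `Exec W B P σ t τ`: the program `P`, started in the memory state `σ`, halts after exactly `t`
elementary steps (instructions and tests) in the state `τ`, and during the execution every integer
written is at most `W` and every rational number written has size at most `B`. -/
inductive Exec (W B : ℕ) : RamProg → RamState → ℕ → RamState → Prop
  | instr (i : RamInstr) (σ : RamState) (h : i.Fits W B σ) :
      Exec W B (.instr i) σ 1 (i.run σ)
  | seq {p q : RamProg} {σ τ ρ : RamState} {t u : ℕ}
      (hp : Exec W B p σ t τ) (hq : Exec W B q τ u ρ) : Exec W B (.seq p q) σ (t + u) ρ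
  | iteTrue {b : RamTest} {p q : RamProg} {σ τ : RamState} {t : ℕ}
      (hb : b.Holds σ) (hp : Exec W B p σ t τ) : Exec W B (.ite b p q) σ (t + 1) τ
  | iteFalse {b : RamTest} {p q : RamProg} {σ τ : RamState} {t : ℕ}
      (hb : ¬ b.Holds σ) (hq : Exec W B q σ t τ) : Exec W B (.ite b p q) σ (t + 1) τ
  | whileTrue {b : RamTest} {p : RamProg} {σ τ ρ : RamState} {t u : ℕ}
      (hb : b.Holds σ) (hp : Exec W B p σ t τ) (hw : Exec W B (.while b p) τ u ρ) :
      Exec W B (.while b p) σ (t + u + 1) ρ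
  | whileFalse {b : RamTest} {p : RamProg} {σ : RamState}
      (hb : ¬ b.Holds σ) : Exec W B (.while b p) σ 1 σ

/-- A computational problem whose instances `x` have dimension `dim x` (the number of numerical
data) and size `size x` (their total binary encoding length), are presented to the machine as
`input x`, and are solved by the final memory states `τ` with `Solves x τ`, can be solved in strongly
polynomial time: some program solves every instance, the number of its steps (and the magnitude of
the integers used for control and addressing) is bounded by a polynomial in the dimension, and the
size of all rational numbers produced is bounded by a polynomial in the size of the instance. -/
def StronglyPolynomial {ι : Type} (dim size : ι → ℕ) (input : ι → RamState)
    (Solves : ι → RamState → Prop) : Prop :=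
  ∃ (P : RamProg) (T S : Polynomial ℕ), ∀ x : ι, ∃ (t : ℕ) (τ : RamState),
    Exec (T.eval (dim x)) (S.eval (size x)) P (input x) t τ ∧
      t ≤ T.eval (dim x) ∧ Solves x τ

/-! ### Factorized binary polynomial optimization with affine factors -/

/-- An instance with `s` blocks of variables and a family of `p` nonempty subsets of the set of
blocks. Members of the family may coincide as sets. -/
structure AffineFBPO (s p : ℕ) where
  n : Fin s → ℕ
  n_pos : ∀ j, 0 < n j
  fam : Fin p → Finset (Fin s)
  fam_nonempty : ∀ i, (fam i).Nonempty
  c : (i : Fin p) → (j : fam i) → Fin (n j) → ℚ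
  d : (i : Fin p) → fam i → ℚ

namespace AffineFBPO

variable {s p : ℕ}

/-- The objective function. -/
def objective (A : AffineFBPO s p) (x : (j : Fin s) → Fin (A.n j) → ℚ) : ℚ :=
  ∑ i : Fin p, ∏ j : A.fam i, ((∑ k : Fin (A.n j), A.c i j k * x j k) + A.d i j)

/-- The feasible points: binary vectors. -/
def feasible (A : AffineFBPO s p) : Set ((j : Fin s) → Fin (A.n j) → ℚ) :=
  {x | ∀ j k, x j k = 0 ∨ x j k = 1}

def IsOptimal (A : AffineFBPO s p) (x : (j : Fin s) → Fin (A.n j) → ℚ) : Prop :=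
  x ∈ A.feasible ∧ IsMaxOn A.objective A.feasible x

/-- The number of variables plus the number of rational coefficients. -/
def dim (A : AffineFBPO s p) : ℕ :=
  (∑ j, A.n j) + ∑ i : Fin p, ∑ j : A.fam i, (A.n j + 1)

/-- The dimension plus the total size of the rational coefficients. -/
def size (A : AffineFBPO s p) : ℕ :=
  A.dim + ∑ i : Fin p, ∑ j : A.fam i,
    ((∑ k : Fin (A.n j), ratSize (A.c i j k)) + ratSize (A.d i j))

open Classical in
/-- The input. Integer register `j` holds the dimension of block `j`; cell `j` of integer array `i`
tells whether `j` belongs to the `i`-th member of the family; if it does, rational array `i * s + j`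
holds the coefficient vector in its first cells, followed by the constant term. All other cells
are zero. -/
noncomputable def input (A : AffineFBPO s p) : RamState where
  reg j := if hj : j < s then A.n ⟨j, hj⟩ else 0
  iarr i j := if ∃ (hi : i < p) (hj : j < s), (⟨j, hj⟩ : Fin s) ∈ A.fam ⟨i, hi⟩ then 1 else 0
  arr a k :=
    if h : ∃ (hi : a / s < p) (hj : a % s < s), (⟨a % s, hj⟩ : Fin s) ∈ A.fam ⟨a / s, hi⟩ then
      if hk : k < A.n ⟨a % s, h.2.1⟩ then A.c ⟨a / s, h.1⟩ ⟨⟨a % s, h.2.1⟩, h.2.2⟩ ⟨k, hk⟩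
      else if k = A.n ⟨a % s, h.2.1⟩ then A.d ⟨a / s, h.1⟩ ⟨⟨a % s, h.2.1⟩, h.2.2⟩
      else 0
    else 0

/-- The output. The solution vector of block `j` is in the first cells of rational array
`p * s + j`. -/
def output (A : AffineFBPO s p) (τ : RamState) : (j : Fin s) → Fin (A.n j) → ℚ :=
  fun j k => τ.arr (p * s + j) k

end AffineFBPO

/-! Freeze all blocks except `j`. The objective is then affine in `x^j`: the coefficient of `x^j_l`
is `∑ i, w i * c l i`, where `c l` is the vector in `ℚ^p` of the `l`-th coefficients of the `p`
factors of block `j` (zero where `j` is not in the member), and `w i` is the product of the other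
factors. So the block may be replaced by the indicator of the positive coefficients without loss
(`value_le_of_sign`). Only the signs of one linear functional `w` on `n_j` vectors in the fixed
dimension `p` matter, and these sign patterns can be listed in polynomial number.

The list comes from an elimination (`exists_pattern`). Move `w` along its first coordinate until the
first value at a vector with nonzero first coordinate vanishes. No value changes to the opposite
sign; a nonzero value that becomes zero had the sign opposite to its change, hence is known from the
direction of the move. The moved functional kills a pivot vector, so subtracting multiples of the
pivot eliminates the coordinate without changing any value. After `p` rounds nothing is left, and
the pattern has been encoded by `p` pivot indices and `p` signs in `{0, 1, -1}`.

Replacing the blocks one after the other (`exists_digits`) shows that every feasible point is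
dominated by a candidate described by `2 * s * p` digits. Every digit string gives a binary point,
so the best candidate is optimal. A fixed number of nested loops enumerates at most `(n_1 ⋯ n_s * 3
^ s) ^ p` strings (`terminates_nestProg`).

Bit sizes stay polynomial because each test evaluates an arithmetic expression whose shape depends
on `s` and `p` only, applied to input data, signs and partial sums of the factors. Such an
expression enlarges sizes by a constant factor (`RatExpr.Bounded.ratBound`), and the partial sums
are bounded by the instance size (`ratBound_factor`). -/

/-! ### Sizes of rational numbers -/

/-- Numerator and denominator are at most `2 ^ b` in absolute value. -/
def RatBound (b : ℕ) (q : ℚ) : Prop := q.num.natAbs ≤ 2 ^ b ∧ q.den ≤ 2 ^ b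

theorem RatBound.mono {b c : ℕ} {q : ℚ} (h : RatBound b q) (hbc : b ≤ c) : RatBound c q :=
  ⟨h.1.trans (Nat.pow_le_pow_right two_pos hbc), h.2.trans (Nat.pow_le_pow_right two_pos hbc)⟩

theorem RatBound.ratSize_le {b : ℕ} {q : ℚ} (h : RatBound b q) : ratSize q ≤ 2 * b + 3 := by
  have key : ∀ m : ℕ, m ≤ 2 ^ b → Nat.size m ≤ b + 1 := fun m hm =>
    Nat.size_le.2 (hm.trans_lt (Nat.pow_lt_pow_right one_lt_two (Nat.lt_succ_self b)))
  have h1 := key _ h.1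
  have h2 := key _ h.2
  unfold ratSize
  omega

theorem ratBound_ratSize (q : ℚ) : RatBound (ratSize q) q := by
  constructor
  · exact (Nat.lt_size_self _).le.trans (Nat.pow_le_pow_right two_pos (by unfold ratSize; omega))
  · exact (Nat.lt_size_self _).le.trans (Nat.pow_le_pow_right two_pos (by unfold ratSize; omega))

theorem one_le_ratSize (q : ℚ) : 1 ≤ ratSize q := by
  unfold ratSize
  omega

/-- Reduction to lowest terms only passes to divisors, so bounds can be read off any unreduced
fraction. The rules for sums, products and inverses rest on this. -/
theorem ratBound_divInt {b : ℕ} {x y : ℤ} (hy : y ≠ 0) (hx : x.natAbs ≤ 2 ^ b)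
    (hyb : y.natAbs ≤ 2 ^ b) : RatBound b (Rat.divInt x y) := by
  constructor
  · rcases eq_or_ne x 0 with rfl | hx0
    · simp
    · exact (Nat.le_of_dvd (Int.natAbs_pos.2 hx0)
        (Int.natAbs_dvd_natAbs.2 (Rat.num_dvd x hy))).trans hx
  · have h := Int.natAbs_dvd_natAbs.2 (Rat.den_dvd x y)
    exact (Nat.le_of_dvd (Int.natAbs_pos.2 hy) (by simpa using h)).trans hyb

theorem ratBound_zero (b : ℕ) : RatBound b 0 := by
  simp [RatBound, Nat.one_le_two_pow]

theorem ratBound_one (b : ℕ) : RatBound b 1 := by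
  simp [RatBound, Nat.one_le_two_pow]

theorem ratBound_neg_one (b : ℕ) : RatBound b (-1) := by
  simp [RatBound, Nat.one_le_two_pow]

theorem RatBound.neg {b : ℕ} {q : ℚ} (h : RatBound b q) : RatBound b (-q) := by
  simpa [RatBound] using h

theorem RatBound.add {b c : ℕ} {q r : ℚ} (hq : RatBound b q) (hr : RatBound c r) :
    RatBound (b + c + 1) (q + r) := by
  have hqd : (q.den : ℤ) ≠ 0 := by exact_mod_cast q.den_nz
  have hrd : (r.den : ℤ) ≠ 0 := by exact_mod_cast r.den_nz
  have h : q + r = Rat.divInt (q.num * r.den + r.num * q.den) (q.den * r.den) := by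
    rw [Rat.add_def', Rat.mkRat_eq_divInt]
    push_cast
    rfl
  rw [h]
  refine ratBound_divInt (mul_ne_zero hqd hrd) ?_ ?_
  · refine (Int.natAbs_add_le _ _).trans ?_
    have h1 := Nat.mul_le_mul hq.1 hr.2
    have h2 := Nat.mul_le_mul hr.1 hq.2
    simp only [Int.natAbs_mul, Int.natAbs_natCast]
    calc _ ≤ 2 ^ b * 2 ^ c + 2 ^ c * 2 ^ b := add_le_add h1 h2
      _ = _ := by ring
  · simp only [Int.natAbs_mul, Int.natAbs_natCast]
    calc _ ≤ 2 ^ b * 2 ^ c := Nat.mul_le_mul hq.2 hr.2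
      _ ≤ 2 ^ (b + c + 1) := by
        rw [← pow_add]
        exact Nat.pow_le_pow_right two_pos (Nat.le_succ _)

theorem RatBound.mul {b c : ℕ} {q r : ℚ} (hq : RatBound b q) (hr : RatBound c r) :
    RatBound (b + c) (q * r) := by
  have hqd : (q.den : ℤ) ≠ 0 := by exact_mod_cast q.den_nz
  have hrd : (r.den : ℤ) ≠ 0 := by exact_mod_cast r.den_nz
  have h : q * r = Rat.divInt (q.num * r.num) (q.den * r.den) := by
    rw [Rat.mul_eq_mkRat, Rat.mkRat_eq_divInt]
    push_cast
    rfl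
  rw [h]
  refine ratBound_divInt (mul_ne_zero hqd hrd) ?_ ?_
  · rw [Int.natAbs_mul, pow_add]
    exact Nat.mul_le_mul hq.1 hr.1
  · rw [Int.natAbs_mul, pow_add]
    exact Nat.mul_le_mul hq.2 hr.2

theorem RatBound.inv {b : ℕ} {q : ℚ} (hq : RatBound b q) : RatBound b q⁻¹ := by
  rcases eq_or_ne q 0 with rfl | h0
  · simpa using hq
  · have h : q⁻¹ = Rat.divInt q.den q.num := by
      rw [Rat.inv_def]
    rw [h]
    exact ratBound_divInt (Rat.num_ne_zero.2 h0) (by simpa using hq.2) hq.1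

theorem RatBound.op {b c : ℕ} {q r : ℚ} (o : RatOp) (hq : RatBound b q) (hr : RatBound c r) :
    RatBound (b + c + 1) (o.eval q r) := by
  cases o with
  | add => exact hq.add hr
  | sub =>
    show RatBound _ (q - r)
    rw [sub_eq_add_neg]
    exact hq.add hr.neg
  | mul => exact (hq.mul hr).mono (Nat.le_succ _)
  | div =>
    show RatBound _ (q / r)
    rw [div_eq_mul_inv]
    exact (hq.mul hr.inv).mono (Nat.le_succ _)

/-- Exponents add, with one extra bit per addition, so a long sum has size linear in the total size
of its terms. -/
theorem ratBound_sum {ι : Type*} (t : Finset ι) (f : ι → ℚ) (b : ι → ℕ) {q : ℚ} {c : ℕ}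
    (hq : RatBound c q) (hf : ∀ i ∈ t, RatBound (b i) (f i)) :
    RatBound (c + ∑ i ∈ t, (b i + 1)) (q + ∑ i ∈ t, f i) := by
  classical
  induction t using Finset.induction_on with
  | empty => simpa using hq
  | insert a t ha ih =>
    rw [Finset.sum_insert ha, Finset.sum_insert ha]
    have h1 := ih fun i hi => hf i (Finset.mem_insert_of_mem hi)
    have h2 := h1.add (hf a (Finset.mem_insert_self a t))
    have e1 : q + (f a + ∑ i ∈ t, f i) = q + ∑ i ∈ t, f i + f a := by ring
    have e2 : c + (b a + 1 + ∑ i ∈ t, (b i + 1)) = c + ∑ i ∈ t, (b i + 1) + b a + 1 := by ring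
    rw [e1, e2]
    exact h2

/-! ### Sign patterns of hyperplane arrangements by iterated elimination -/

/-- The vectors `c l` after the elimination of the coordinates below `m`, the pivot for coordinate
`i` being the vector with index `k i`. -/
def reduced (c : ℕ → ℕ → ℚ) (k : ℕ → ℕ) : ℕ → ℕ → ℕ → ℚ
  | 0, l, i => c l i
  | m + 1, l, i => reduced c k m l i
      - reduced c k m l m / reduced c k m (k m) m * reduced c k m (k m) i

/-- A number whose sign is that of the last nonzero one among `τ i * reduced c k i l i`,
`i < m`. -/
def pattern (c : ℕ → ℕ → ℚ) (k : ℕ → ℕ) (τ : ℕ → ℚ) : ℕ → ℕ → ℚ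
  | 0, _ => 0
  | m + 1, l => pattern c k τ m l
      + τ m * reduced c k m l m / (τ m * reduced c k m l m)
        * (τ m * reduced c k m l m - pattern c k τ m l)

theorem reduced_congr {c : ℕ → ℕ → ℚ} {k k' : ℕ → ℕ} {m : ℕ} (h : ∀ i < m, k i = k' i) :
    reduced c k m = reduced c k' m := by
  induction m with
  | zero => rfl
  | succ m ih =>
    funext l i
    simp only [reduced]
    rw [ih fun i hi => h i (Nat.lt_succ_of_lt hi), h m (Nat.lt_succ_self m)]

theorem pattern_congr {c : ℕ → ℕ → ℚ} {k k' : ℕ → ℕ} {τ τ' : ℕ → ℚ} {m : ℕ}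
    (h : ∀ i < m, k i = k' i) (hτ : ∀ i < m, τ i = τ' i) :
    pattern c k τ m = pattern c k' τ' m := by
  induction m with
  | zero => rfl
  | succ m ih =>
    funext l
    simp only [pattern]
    rw [ih (fun i hi => h i (Nat.lt_succ_of_lt hi)) fun i hi => hτ i (Nat.lt_succ_of_lt hi),
      hτ m (Nat.lt_succ_self m), reduced_congr fun i hi => h i (Nat.lt_succ_of_lt hi)]

/-- Since `0 / 0 = 0`, the quotient `x / x` is the indicator of `x ≠ 0`. The recursion thus
overwrites by `x` exactly when `x ≠ 0`, without branching, and can be evaluated as a pure arithmetic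
expression. -/
theorem pattern_succ_of_eq_zero {c : ℕ → ℕ → ℚ} {k : ℕ → ℕ} {τ : ℕ → ℚ} {m l : ℕ}
    (h : τ m * reduced c k m l m = 0) : pattern c k τ (m + 1) l = pattern c k τ m l := by
  simp [pattern, h]

theorem pattern_succ_of_ne_zero {c : ℕ → ℕ → ℚ} {k : ℕ → ℕ} {τ : ℕ → ℚ} {m l : ℕ}
    (h : τ m * reduced c k m l m ≠ 0) :
    pattern c k τ (m + 1) l = τ m * reduced c k m l m := by
  simp only [pattern]
  rw [div_self h]
  ring

/-- One elimination step: a pivot and a sign `t`, such that moving the functional along the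
eliminated coordinate until the first hyperplane is hit preserves the nonzero signs. -/
theorem exists_pivot {n : ℕ} (hn : 0 < n) (S a : ℕ → ℚ) :
    ∃ k < n, ∃ t : ℚ, (∀ l < n, a l ≠ 0 → a k ≠ 0) ∧ (a k ≠ 0 → S k + t * a k = 0) ∧
      ∀ l < n, |t * a l| ≤ |S l| := by
  by_cases h : ∃ l < n, a l ≠ 0
  · have hne : ((Finset.range n).filter fun l => a l ≠ 0).Nonempty := by
      obtain ⟨l, hl, hal⟩ := h
      exact ⟨l, by simp [hl, hal]⟩
    -- The smallest quotient is the shortest move that makes some value vanish; minimality is what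
    -- gives `|t * a l| ≤ |S l|`.
    obtain ⟨k, hk, hmin⟩ := Finset.exists_min_image _ (fun l => |S l / a l|) hne
    simp only [Finset.mem_filter, Finset.mem_range] at hk hmin
    refine ⟨k, hk.1, -(S k / a k), fun _ _ _ => hk.2, fun h0 => ?_, fun l hl => ?_⟩
    · field_simp
      ring
    · rcases eq_or_ne (a l) 0 with h0 | h0
      · simp [h0]
      · have h1 := hmin l ⟨hl, h0⟩
        rw [abs_mul, abs_neg]
        calc |S k / a k| * |a l| ≤ |S l / a l| * |a l| := by gcongr
          _ = |S l| := by rw [← abs_mul, div_mul_cancel₀ _ h0]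
  · push Not at h
    -- The coordinate vanishes on all vectors: a dummy pivot and no move.
    exact ⟨0, hn, 0, fun l hl h1 => absurd (h l hl) h1, fun h1 => absurd (h 0 hn) h1,
      fun l _ => by simp⟩

/-- A change `u` no larger than `S` can cancel `S` but not reverse it. If it cancels a nonzero `S`,
then `-u = S`; if `S = 0`, then `u = 0` and the decision is left to `y`. -/
theorem sign_step {S u y : ℚ} (h : |u| ≤ |S|) :
    (if S + u ≠ 0 then SignType.sign (S + u)
      else if u ≠ 0 then SignType.sign (-u) else SignType.sign y)
      = if S ≠ 0 then SignType.sign S else SignType.sign y := by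
  rcases lt_trichotomy S 0 with hS | hS | hS
  · rw [abs_of_neg hS] at h
    have h1 := abs_le.1 h
    rw [if_pos hS.ne, sign_neg hS]
    split_ifs with h2 h3
    · exact sign_neg (lt_of_le_of_ne (by linarith) h2)
    · exact sign_neg (by
        have : S + u = 0 := not_not.1 h2
        linarith)
    · exfalso
      apply h2
      rw [not_not.1 h3]
      linarith
  · subst hS
    have h1 : u = 0 := by simpa using h
    simp [h1]
  · rw [abs_of_pos hS] at h
    have h1 := abs_le.1 h
    rw [if_pos hS.ne', sign_pos hS]
    split_ifs with h2 h3
    · exact sign_pos (lt_of_le_of_ne (by linarith) (Ne.symm h2))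
    · exact sign_pos (by
        have : S + u = 0 := not_not.1 h2
        linarith)
    · exfalso
      apply h2
      rw [not_not.1 h3]
      linarith

/-- The right side is the functional with `w m` replaced by `w m + t`. It vanishes on the pivot
vector, so elimination preserves its values, and the eliminated coordinate drops out of the sum. If
the pivot entry is zero, so is the entry of `l`, and nothing is subtracted. -/
theorem sum_reduced_succ (c : ℕ → ℕ → ℚ) (k : ℕ → ℕ) (w : ℕ → ℚ) {m p l : ℕ} (hmp : m < p) {t : ℚ}
    (h1 : reduced c k m l m ≠ 0 → reduced c k m (k m) m ≠ 0)
    (h2 : reduced c k m (k m) m ≠ 0 →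
      ∑ i ∈ Finset.Ico m p, w i * reduced c k m (k m) i + t * reduced c k m (k m) m = 0) :
    ∑ i ∈ Finset.Ico (m + 1) p, w i * reduced c k (m + 1) l i
      = ∑ i ∈ Finset.Ico m p, w i * reduced c k m l i + t * reduced c k m l m := by
  rcases eq_or_ne (reduced c k m l m) 0 with h0 | h0
  · rw [Finset.sum_eq_sum_Ico_succ_bot hmp, h0]
    simp [reduced, h0]
  · have h3 := h2 (h1 h0)
    have h4 := h1 h0
    rw [Finset.sum_eq_sum_Ico_succ_bot hmp] at h3 ⊢
    simp only [reduced, mul_sub, Finset.sum_sub_distrib]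
    have h5 : ∑ i ∈ Finset.Ico (m + 1) p, w i * (reduced c k m l m / reduced c k m (k m) m
          * reduced c k m (k m) i)
        = reduced c k m l m / reduced c k m (k m) m
          * ∑ i ∈ Finset.Ico (m + 1) p, w i * reduced c k m (k m) i := by
      rw [Finset.mul_sum]
      exact Finset.sum_congr rfl fun i _ => by ring
    have h6 : ∑ i ∈ Finset.Ico (m + 1) p, w i * reduced c k m (k m) i
        = -(w m + t) * reduced c k m (k m) m := by linarith
    rw [h5, h6]
    field_simp
    ring

/-- Induction on the number `r` of remaining coordinates. The choices below `m` are kept, and they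
decide the sign only where the remaining functional vanishes; this is why the last nonzero entry
wins in `pattern`. -/
theorem exists_pattern_aux (c : ℕ → ℕ → ℚ) (w : ℕ → ℚ) {n : ℕ} (hn : 0 < n) (p r m : ℕ)
    (hm : m + r = p) (k : ℕ → ℕ) (τ : ℕ → ℚ) :
    ∃ (k' : ℕ → ℕ) (τ' : ℕ → ℚ), (∀ i < m, k' i = k i) ∧ (∀ i < m, τ' i = τ i) ∧
      (∀ i, m ≤ i → k' i < n) ∧ (∀ i, m ≤ i → τ' i = 0 ∨ τ' i = 1 ∨ τ' i = -1) ∧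
      ∀ l < n, SignType.sign (pattern c k' τ' p l)
        = if ∑ i ∈ Finset.Ico m p, w i * reduced c k m l i ≠ 0
          then SignType.sign (∑ i ∈ Finset.Ico m p, w i * reduced c k m l i)
          else SignType.sign (pattern c k τ m l) := by
  induction r generalizing m k τ with
  | zero =>
    obtain rfl : m = p := by omega
    refine ⟨fun i => if i < m then k i else 0, fun i => if i < m then τ i else 0,
      fun i hi => if_pos hi, fun i hi => if_pos hi, fun i hi => ?_, fun i hi => ?_,
      fun l _ => ?_⟩
    · simpa [not_lt.2 hi] using hn
    · simp [not_lt.2 hi]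
    · rw [pattern_congr (k' := k) (τ' := τ) (fun i hi => if_pos hi) fun i hi => if_pos hi]
      simp
  | succ r ih =>
    have hmp : m < p := by omega
    obtain ⟨q, hq, t, hq1, hq2, hq3⟩ := exists_pivot hn
      (fun l => ∑ i ∈ Finset.Ico m p, w i * reduced c k m l i) fun l => reduced c k m l m
    -- Minus the sign of `t`: a value cancelled by the move was `-(t * a l)`, and only its sign is
    -- needed, so three choices suffice.
    set ε : ℚ := if 0 < t then -1 else if t < 0 then 1 else 0 with hε
    obtain ⟨k', τ', hk', hτ', hkn, hτn, hs⟩ := ih (m + 1) (by omega)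
      (Function.update k m q) (Function.update τ m ε)
    have hkm : ∀ i < m, Function.update k m q i = k i :=
      fun i hi => Function.update_of_ne hi.ne _ _
    have hτm : ∀ i < m, Function.update τ m ε i = τ i :=
      fun i hi => Function.update_of_ne hi.ne _ _
    refine ⟨k', τ', fun i hi => (hk' i (by omega)).trans (hkm i hi),
      fun i hi => (hτ' i (by omega)).trans (hτm i hi), fun i hi => ?_, fun i hi => ?_,
      fun l hl => ?_⟩
    · rcases Nat.eq_or_lt_of_le hi with rfl | hi
      · rw [hk' m (Nat.lt_succ_self m), Function.update_self]
        exact hq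
      · exact hkn i hi
    · rcases Nat.eq_or_lt_of_le hi with rfl | hi
      · rw [hτ' m (Nat.lt_succ_self m), Function.update_self, hε]
        split_ifs <;> simp
      · exact hτn i hi
    · have hred : reduced c (Function.update k m q) m = reduced c k m := reduced_congr hkm
      have hpat : pattern c (Function.update k m q) (Function.update τ m ε) m
          = pattern c k τ m := pattern_congr hkm hτm
      rw [hs l hl, sum_reduced_succ c (Function.update k m q) w hmp (t := t)
        (by simpa [hred] using hq1 l hl) (by simpa [hred] using hq2), hred,
        ← sign_step (hq3 l hl)]
      congr 1
      have hu : Function.update τ m ε m * reduced c (Function.update k m q) m l m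
          = ε * reduced c k m l m := by rw [Function.update_self, hred]
      have hεt : SignType.sign (ε * reduced c k m l m)
          = SignType.sign (-(t * reduced c k m l m)) := by
        rw [← neg_mul, sign_mul, sign_mul]
        congr 1
        rcases lt_trichotomy t 0 with h | h | h
        · simp [hε, h, not_lt.2 h.le]
        · simp [hε, h]
        · simp [hε, h]
      split_ifs with h
      · have : ε * reduced c k m l m ≠ 0 := by
          rw [← sign_ne_zero, hεt, sign_ne_zero]
          exact neg_ne_zero.2 h
        rw [pattern_succ_of_ne_zero (by rwa [hu]), hu, hεt]
      · have : ε * reduced c k m l m = 0 := by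
          rw [← sign_eq_zero_iff, hεt, sign_eq_zero_iff]
          exact neg_eq_zero.2 (not_not.1 h)
        rw [pattern_succ_of_eq_zero (by rwa [hu]), hpat]

/-- Every sign pattern of a linear functional on the vectors `c l` is a pattern of an iterated
elimination. -/
theorem exists_pattern (c : ℕ → ℕ → ℚ) (w : ℕ → ℚ) {n : ℕ} (hn : 0 < n) (p : ℕ) :
    ∃ (k : ℕ → ℕ) (τ : ℕ → ℚ), (∀ i, k i < n) ∧ (∀ i, τ i = 0 ∨ τ i = 1 ∨ τ i = -1) ∧
      ∀ l < n, SignType.sign (pattern c k τ p l)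
        = SignType.sign (∑ i ∈ Finset.range p, w i * c l i) := by
  obtain ⟨k, τ, -, -, hk, hτ, h⟩ := exists_pattern_aux c w hn p p 0 (zero_add p) (fun _ => 0)
    fun _ => 0
  refine ⟨k, τ, fun i => hk i (Nat.zero_le i), fun i => hτ i (Nat.zero_le i), fun l hl => ?_⟩
  rw [h l hl]
  by_cases h0 : ∑ i ∈ Finset.range p, w i * c l i = 0
  · simp [pattern, reduced, h0]
  · simp [reduced, h0]

/-! ### Execution with postconditions -/

/-- The program, started in `σ`, halts after at most `T` steps in a state which satisfies `Q`,
writing only integers at most `W` and rationals of size at most `B`. -/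
def Terminates (W B : ℕ) (P : RamProg) (T : ℕ) (σ : RamState) (Q : RamState → Prop) : Prop :=
  ∃ (t : ℕ) (τ : RamState), Exec W B P σ t τ ∧ t ≤ T ∧ Q τ

section Rules

variable {W B : ℕ}

theorem Terminates.mono {P : RamProg} {T T' : ℕ} {σ : RamState} {Q Q' : RamState → Prop}
    (h : Terminates W B P T σ Q) (hT : T ≤ T') (hQ : ∀ τ, Q τ → Q' τ) :
    Terminates W B P T' σ Q' := by
  obtain ⟨t, τ, h1, h2, h3⟩ := h
  exact ⟨t, τ, h1, h2.trans hT, hQ τ h3⟩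

theorem terminates_instr {i : RamInstr} {σ : RamState} {Q : RamState → Prop}
    (h : i.Fits W B σ) (hQ : Q (i.run σ)) : Terminates W B (.instr i) 1 σ Q :=
  ⟨1, _, .instr i σ h, le_rfl, hQ⟩

theorem Terminates.seq {P P' : RamProg} {T T' : ℕ} {σ : RamState} {Q R : RamState → Prop}
    (h : Terminates W B P T σ Q) (h' : ∀ τ, Q τ → Terminates W B P' T' τ R) :
    Terminates W B (.seq P P') (T + T') σ R := by
  obtain ⟨t, τ, h1, h2, h3⟩ := h
  obtain ⟨u, ρ, h4, h5, h6⟩ := h' τ h3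
  exact ⟨t + u, ρ, .seq h1 h4, add_le_add h2 h5, h6⟩

theorem terminates_ite {b : RamTest} {P P' : RamProg} {T : ℕ} {σ : RamState}
    {Q : RamState → Prop} (h : b.Holds σ → Terminates W B P T σ Q)
    (h' : ¬ b.Holds σ → Terminates W B P' T σ Q) : Terminates W B (.ite b P P') (T + 1) σ Q := by
  by_cases hb : b.Holds σ
  · obtain ⟨t, τ, h1, h2, h3⟩ := h hb
    exact ⟨t + 1, τ, .iteTrue hb h1, Nat.succ_le_succ h2, h3⟩
  · obtain ⟨t, τ, h1, h2, h3⟩ := h' hb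
    exact ⟨t + 1, τ, .iteFalse hb h1, Nat.succ_le_succ h2, h3⟩

/-- `for r < n do P`, where the register `one` holds the number one. -/
def forLoop (one r n : ℕ) (P : RamProg) : RamProg :=
  .seq (.instr (.const r 0)) (.while (.intLt r n) (.seq P (.instr (.intOp .add r r one))))

/-- Induction on the number `d` of remaining rounds. Each round costs the body, one test and one
increment; the final `1` is the failing test. -/
theorem terminates_while {one r n N T : ℕ} {P : RamProg} (Inv : ℕ → RamState → Prop)
    (hr : ∀ l τ, Inv l τ → τ.reg r = l) (hn : ∀ l τ, Inv l τ → τ.reg n = N)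
    (hP : ∀ l < N, ∀ τ, Inv l τ → Terminates W B P T τ fun τ' =>
      τ'.reg r + τ'.reg one ≤ W ∧ Inv (l + 1) (τ'.setReg r (τ'.reg r + τ'.reg one)))
    (d : ℕ) : ∀ l, l + d = N → ∀ σ, Inv l σ →
    Terminates W B (.while (.intLt r n) (.seq P (.instr (.intOp .add r r one))))
      (d * (T + 2) + 1) σ (Inv N) := by
  induction d with
  | zero =>
    intro l hl σ hσ
    obtain rfl : l = N := by omega
    refine ⟨1, σ, .whileFalse ?_, by omega, hσ⟩
    simp only [RamTest.Holds, hr l σ hσ, hn l σ hσ]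
    exact lt_irrefl l
  | succ d ih =>
    intro l hl σ hσ
    obtain ⟨t, τ, h1, h2, h3, h4⟩ := hP l (by omega) σ hσ
    obtain ⟨u, ρ, h5, h6, h7⟩ := ih (l + 1) (by omega) _ h4
    refine ⟨t + 1 + u + 1, ρ, .whileTrue ?_ (.seq h1 (.instr _ _ h3)) h5, ?_, h7⟩
    · simp only [RamTest.Holds, hr l σ hσ, hn l σ hσ]
      omega
    · have : (d + 1) * (T + 2) = d * (T + 2) + T + 2 := by ring
      omega

theorem terminates_forLoop {one r n N T : ℕ} {P : RamProg} {σ : RamState}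
    (Inv : ℕ → RamState → Prop) (h0 : Inv 0 (σ.setReg r 0))
    (hr : ∀ l τ, Inv l τ → τ.reg r = l) (hn : ∀ l τ, Inv l τ → τ.reg n = N)
    (hP : ∀ l < N, ∀ τ, Inv l τ → Terminates W B P T τ fun τ' =>
      τ'.reg r + τ'.reg one ≤ W ∧ Inv (l + 1) (τ'.setReg r (τ'.reg r + τ'.reg one))) :
    Terminates W B (forLoop one r n P) (1 + (N * (T + 2) + 1)) σ (Inv N) :=
  (terminates_instr (i := .const r 0) (Q := Inv 0) (Nat.zero_le W) h0).seq fun τ hτ =>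
    terminates_while Inv hr hn hP N 0 (zero_add N) τ hτ

/-- `f 0; …; f (m - 1)`, preceded by clearing register `r`. -/
def seqTo (r : ℕ) (f : ℕ → RamProg) : ℕ → RamProg
  -- There is no empty program; clearing a scratch register takes its place.
  | 0 => .instr (.const r 0)
  | m + 1 => .seq (seqTo r f m) (f m)

theorem terminates_seqTo {r T : ℕ} {f : ℕ → RamProg} {σ : RamState} (Inv : ℕ → RamState → Prop)
    (h0 : Inv 0 (σ.setReg r 0)) (m : ℕ)
    (h : ∀ l < m, ∀ τ, Inv l τ → Terminates W B (f l) T τ (Inv (l + 1))) :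
    Terminates W B (seqTo r f m) (m * T + 1) σ (Inv m) := by
  induction m with
  | zero => exact (terminates_instr (i := .const r 0) (Nat.zero_le W) h0).mono (by omega) fun _ h => h
  | succ m ih =>
    refine ((ih fun l hl => h l (Nat.lt_succ_of_lt hl)).seq
      fun τ hτ => h m (Nat.lt_succ_self m) τ hτ).mono ?_ fun _ h => h
    have : (m + 1) * T = m * T + T := by ring
    omega

end Rules

/-! ### Rational expressions -/

inductive RatExpr
  | cell (x : RatCell)
  | const (q : ℚ)
  | op (o : RatOp) (a b : RatExpr)

namespace RatExpr

def eval (σ : RamState) : RatExpr → ℚ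
  | cell x => σ.read x
  | const q => q
  | op o a b => o.eval (a.eval σ) (b.eval σ)

/-- The cost of an expression: a bound for the number of steps of its evaluation, and for the
factor by which the size of the result exceeds the size of the cells. -/
def weight : RatExpr → ℕ
  | cell _ => 1
  | const q => ratSize q
  | op _ a b => a.weight + b.weight + 1

/-- The cells of the expression lie in arrays with names below `d`, and hold numbers bounded by
`2 ^ b`. -/
def Bounded (d b : ℕ) (σ : RamState) : RatExpr → Prop
  | cell x => x.array < d ∧ RatBound b (σ.read x)
  | const _ => True
  | op _ x y => x.Bounded d b σ ∧ y.Bounded d b σ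

/-- Evaluates the expression into array `d` at the index in register `z`, with the arrays with
names at least `d` as scratch memory. -/
def compile (z : ℕ) : RatExpr → ℕ → RamProg
  | cell x, d => .instr (.ratCopy ⟨d, z⟩ x)
  | const q, d => .instr (.ratConst ⟨d, z⟩ q)
  | op o a b, d =>
    .seq (a.compile z d) (.seq (b.compile z (d + 1)) (.instr (.ratOp o ⟨d, z⟩ ⟨d, z⟩ ⟨d + 1, z⟩)))

variable {W B b d z : ℕ} {σ : RamState}

/-- Weights obey the same recursion as exponents under `RatBound.op`: they add, plus one for the
operation. -/
theorem Bounded.ratBound {e : RatExpr} (h : e.Bounded d b σ) :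
    RatBound (e.weight * (b + 1)) (e.eval σ) := by
  induction e with
  | cell x => exact h.2.mono (by simp [weight])
  | const q =>
    refine (ratBound_ratSize q).mono ?_
    simp only [weight]
    exact Nat.le_mul_of_pos_right _ (Nat.succ_pos b)
  | op o x y hx hy =>
    refine ((hx h.1).op o (hy h.2)).mono ?_
    simp only [weight]
    ring_nf
    omega

theorem weight_pos (e : RatExpr) : 1 ≤ e.weight := by
  cases e with
  | cell x => exact le_rfl
  | const q => exact one_le_ratSize q
  | op o x y => exact Nat.le_add_left 1 _

/-- Used when the first operand has been stored in array `d`: the second one reads only arrays below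
`d`, so its value is unaffected, and it can be compiled with scratch memory from `d + 1` on. -/
theorem eval_congr {τ : RamState} {e : RatExpr} (h : e.Bounded d b σ) (hreg : τ.reg = σ.reg)
    (harr : ∀ a < d, τ.arr a = σ.arr a) : e.eval τ = e.eval σ ∧ e.Bounded (d + 1) b τ := by
  induction e with
  | cell x =>
    have h1 : τ.read x = σ.read x := by simp only [RamState.read, hreg, harr _ h.1]
    exact ⟨h1, Nat.lt_succ_of_lt h.1, h1 ▸ h.2⟩
  | const q => exact ⟨rfl, trivial⟩
  | op o x y hx hy =>
    obtain ⟨h1, h2⟩ := hx h.1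
    obtain ⟨h3, h4⟩ := hy h.2
    exact ⟨by simp only [eval, h1, h3], h2, h4⟩

theorem terminates_compile {e : RatExpr} (h : e.Bounded d b σ)
    (hB : 2 * (e.weight * (b + 1)) + 3 ≤ B) :
    Terminates W B (e.compile z d) e.weight σ fun τ => τ.reg = σ.reg ∧ τ.iarr = σ.iarr ∧
      (∀ a < d, τ.arr a = σ.arr a) ∧ τ.arr d (σ.reg z) = e.eval σ := by
  have hval := h.ratBound.ratSize_le.trans hB
  induction e generalizing d σ with
  | cell x =>
    refine terminates_instr hval ⟨rfl, rfl, fun a ha => ?_, ?_⟩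
    · exact Function.update_of_ne ha.ne _ _
    · simp [RamInstr.run, RamState.write, eval]
  | const q =>
    refine (terminates_instr (i := .ratConst ⟨d, z⟩ q) hval ⟨rfl, rfl, fun a ha => ?_, ?_⟩).mono
      (weight_pos (const q)) fun _ h => h
    · exact Function.update_of_ne ha.ne _ _
    · simp [RamInstr.run, RamState.write, eval]
  | op o x y hx hy =>
    have hB' : 2 * (x.weight * (b + 1)) + 3 ≤ B ∧ 2 * (y.weight * (b + 1)) + 3 ≤ B := by
      simp only [weight] at hB
      ring_nf at hB ⊢
      omega
    refine ((hx h.1 hB'.1 (h.1.ratBound.ratSize_le.trans hB'.1)).seq (T' := y.weight + 1)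
      fun τ hτ => ?_).mono (by simp only [weight]; omega) fun _ h => h
    obtain ⟨hr, hi, ha, hd⟩ := hτ
    obtain ⟨hy1, hy2⟩ := eval_congr h.2 hr ha
    refine (hy hy2 hB'.2 (hy2.ratBound.ratSize_le.trans hB'.2)).seq fun ρ hρ => ?_
    obtain ⟨hr', hi', ha', hd'⟩ := hρ
    have h1 : ρ.read ⟨d, z⟩ = x.eval σ := by
      simp only [RamState.read, hr', hr, ha' d (Nat.lt_succ_self d), hd]
    have h2 : ρ.read ⟨d + 1, z⟩ = y.eval σ := by
      simp only [RamState.read, hr', hd', hy1]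
    have hv : o.eval (ρ.read ⟨d, z⟩) (ρ.read ⟨d + 1, z⟩) = (op o x y).eval σ := by
      simp only [h1, h2, eval]
    refine terminates_instr ?_ ⟨hr'.trans hr, hi'.trans hi, fun a had => ?_, ?_⟩
    · simp only [RamInstr.Fits, hv]
      exact hval
    · rw [← ha a had, ← ha' a (Nat.lt_succ_of_lt had)]
      exact Function.update_of_ne had.ne _ _
    · simp only [RamInstr.run, RamState.write, hv]
      rw [hr', hr]
      simp

/-- Assigns the value of the expression to a cell, with the arrays with names at least `d` as
scratch memory. -/
def assign (z d : ℕ) (x : RatCell) (e : RatExpr) : RamProg :=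
  .seq (e.compile z d) (.instr (.ratCopy x ⟨d, z⟩))

theorem terminates_assign {e : RatExpr} {x : RatCell} {Q : RamState → Prop}
    (h : e.Bounded d b σ) (hB : 2 * (e.weight * (b + 1)) + 3 ≤ B)
    (hQ : ∀ τ : RamState, τ.reg = σ.reg → τ.iarr = σ.iarr →
      (∀ a < d, a ≠ x.array → τ.arr a = σ.arr a) →
      (x.array < d → τ.arr x.array
        = Function.update (σ.arr x.array) (σ.reg x.index) (e.eval σ)) → Q τ) :
    Terminates W B (assign z d x e) (e.weight + 1) σ Q := by
  refine (terminates_compile h hB).seq fun τ hτ => ?_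
  obtain ⟨hr, hi, ha, hd⟩ := hτ
  have hv : τ.read ⟨d, z⟩ = e.eval σ := by simp only [RamState.read, hr, hd]
  refine terminates_instr ?_ (hQ _ hr hi (fun a had hne => ?_) fun hx => ?_)
  · simp only [RamInstr.Fits, hv]
    exact h.ratBound.ratSize_le.trans hB
  · rw [← ha a had]
    exact Function.update_of_ne hne _ _
  · simp only [RamInstr.run, RamState.write, hv, hr, ha _ hx]
    simp

end RatExpr

namespace AffineFBPO

/-! ### The memory layout

Register `j < s` holds the dimension of block `j`, the array `i * s + j` the coefficients. -/

abbrev zeroReg (s : ℕ) : ℕ := s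

abbrev oneReg (s : ℕ) : ℕ := s + 1

abbrev threeReg (s : ℕ) : ℕ := s + 2

abbrev loopReg (s : ℕ) : ℕ := s + 3

/-- The registers of the current pivots (even `u`) and signs (odd `u`). -/
abbrev digitReg (s u : ℕ) : ℕ := s + 4 + 2 * u

/-- The registers of the best pivots and signs found so far. -/
abbrev bestReg (s u : ℕ) : ℕ := s + 5 + 2 * u

abbrev outArr (s p j : ℕ) : ℕ := p * s + j

abbrev bestArr (s p : ℕ) : ℕ := p * s + s

/-- The array `0, 1, -1, 0, 0, …`. -/
abbrev signArr (s p : ℕ) : ℕ := p * s + s + 1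

abbrev factorArr (s p u : ℕ) : ℕ := p * s + s + 2 + u

abbrev valueArr (s p : ℕ) : ℕ := p * s + s + 2 + p * s

abbrev tmpArr (s p : ℕ) : ℕ := p * s + s + 3 + p * s

def signs : ℕ → ℚ := Function.update (Function.update (fun _ => 0) 1 1) 2 (-1)

theorem mul_add_lt {s p i j : ℕ} (hi : i < p) (hj : j < s) : i * s + j < p * s :=
  calc i * s + j < i * s + s := Nat.add_lt_add_left hj _
    _ = (i + 1) * s := by ring
    _ ≤ p * s := Nat.mul_le_mul_right s hi

/-! ### What the program computes -/

/-- The factor `u = i * s + j`, after summation of the first `l` terms. Factors which do not occur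
in the objective are constantly one. -/
def factor (s : ℕ) (σ₀ : RamState) (u : ℕ) (x : ℕ → ℚ) (l : ℕ) : ℚ :=
  (if 0 < σ₀.iarr (u / s) (u % s) then σ₀.arr u (σ₀.reg (u % s)) else 1)
    + ∑ k ∈ Finset.range l, σ₀.arr u k * x k

def value (s p : ℕ) (σ₀ : RamState) (x : ℕ → ℕ → ℚ) : ℚ :=
  ∑ i ∈ Finset.range p, ∏ j ∈ Finset.range s, factor s σ₀ (i * s + j) (x j) (σ₀.reg j)

/-- The binary vectors described by pivots and signs. -/
def candidate (s p : ℕ) (σ₀ : RamState) (δ : ℕ → ℕ) (j l : ℕ) : ℚ :=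
  if 0 < pattern (fun l i => σ₀.arr (i * s + j) l) (fun m => δ (2 * (j * p + m)))
    (fun m => signs (δ (2 * (j * p + m) + 1))) p l then 1 else 0

theorem candidate_eq (s p : ℕ) (σ₀ : RamState) (δ : ℕ → ℕ) (j l : ℕ) :
    candidate s p σ₀ δ j l = 0 ∨ candidate s p σ₀ δ j l = 1 := by
  unfold candidate
  split_ifs <;> simp

theorem candidate_congr {s p : ℕ} {σ₀ : RamState} {δ δ' : ℕ → ℕ}
    (h : ∀ u < 2 * (s * p), δ u = δ' u) {j : ℕ} (hj : j < s) :
    candidate s p σ₀ δ j = candidate s p σ₀ δ' j := by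
  funext l
  unfold candidate
  rw [pattern_congr (k' := fun m => δ' (2 * (j * p + m)))
    (τ' := fun m => signs (δ' (2 * (j * p + m) + 1)))]
  · intro i hi
    exact h _ (by have := mul_add_lt hj hi; omega)
  · intro i hi
    have : 2 * (j * p + i) + 1 < 2 * (s * p) := by have := mul_add_lt hj hi; omega
    simp only [h _ this]

theorem value_congr {s p : ℕ} {σ₀ : RamState} {x y : ℕ → ℕ → ℚ}
    (h : ∀ j < s, ∀ k < σ₀.reg j, x j k = y j k) : value s p σ₀ x = value s p σ₀ y := by
  unfold value factor
  refine Finset.sum_congr rfl fun i _ => Finset.prod_congr rfl fun j hj => ?_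
  congr 1
  exact Finset.sum_congr rfl fun k hk => by
    rw [h j (Finset.mem_range.1 hj) k (Finset.mem_range.1 hk)]

theorem value_candidate_congr {s p : ℕ} {σ₀ : RamState} {δ δ' : ℕ → ℕ}
    (h : ∀ u < 2 * (s * p), δ u = δ' u) :
    value s p σ₀ (candidate s p σ₀ δ) = value s p σ₀ (candidate s p σ₀ δ') :=
  value_congr fun j hj k _ => by rw [candidate_congr h hj]

/-! ### The program -/

/-- The elimination is unrolled at the time of writing the program. Only register contents vary
between instances, so cost and growth of sizes are constants. -/
def reducedExpr (s p j : ℕ) : ℕ → ℕ → ℕ → RatExpr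
  | 0, r, i => .cell ⟨i * s + j, r⟩
  | m + 1, r, i =>
    .op .sub (reducedExpr s p j m r i)
      (.op .mul (.op .div (reducedExpr s p j m r m)
        (reducedExpr s p j m (digitReg s (2 * (j * p + m))) m))
        (reducedExpr s p j m (digitReg s (2 * (j * p + m))) i))

def signedExpr (s p j m r : ℕ) : RatExpr :=
  .op .mul (.cell ⟨signArr s p, digitReg s (2 * (j * p + m) + 1)⟩) (reducedExpr s p j m r m)

def patternExpr (s p j : ℕ) : ℕ → ℕ → RatExpr
  | 0, _ => .const 0
  | m + 1, r =>
    .op .add (patternExpr s p j m r)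
      (.op .mul (.op .div (signedExpr s p j m r) (signedExpr s p j m r))
        (.op .sub (signedExpr s p j m r) (patternExpr s p j m r)))

def prodExpr (s p i : ℕ) : ℕ → RatExpr
  | 0 => .const 1
  | j + 1 => .op .mul (prodExpr s p i j) (.cell ⟨factorArr s p (i * s + j), zeroReg s⟩)

def sumExpr (s p : ℕ) : ℕ → RatExpr
  | 0 => .const 0
  | i + 1 => .op .add (sumExpr s p i) (prodExpr s p i s)

def termExpr (s p u : ℕ) : RatExpr :=
  .op .add (.cell ⟨factorArr s p u, zeroReg s⟩)
    (.op .mul (.cell ⟨u, loopReg s⟩) (.cell ⟨outArr s p (u % s), loopReg s⟩))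

/-- Computes the candidate for block `j`. -/
def blockProg (s p j : ℕ) : RamProg :=
  forLoop (oneReg s) (loopReg s) j
    (.seq (RatExpr.assign (zeroReg s) (tmpArr s p) ⟨valueArr s p, zeroReg s⟩
      (patternExpr s p j p (loopReg s)))
    -- Cell `0` of the sign array holds `0`, so this tests positivity.
    (.ite (.ratLt ⟨signArr s p, zeroReg s⟩ ⟨valueArr s p, zeroReg s⟩)
      (.instr (.ratConst ⟨outArr s p j, loopReg s⟩ 1))
      (.instr (.ratConst ⟨outArr s p j, loopReg s⟩ 0))))

/-- Computes factor `u`. -/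
def factorProg (s p u : ℕ) : RamProg :=
  .seq (.instr (.const (loopReg s) (u % s)))
  (.seq (.instr (.load (loopReg s) (u / s) (loopReg s)))
  (.seq (.ite (.intLt (zeroReg s) (loopReg s))
      -- Register `u % s` holds the block dimension, which is exactly the address of the constant
      -- term.
      (.instr (.ratCopy ⟨factorArr s p u, zeroReg s⟩ ⟨u, u % s⟩))
      (.instr (.ratConst ⟨factorArr s p u, zeroReg s⟩ 1)))
    (forLoop (oneReg s) (loopReg s) (u % s)
      (RatExpr.assign (zeroReg s) (tmpArr s p) ⟨factorArr s p u, zeroReg s⟩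
        (termExpr s p u)))))

/-- Computes the candidate described by the digits, and its value. -/
def evalProg (s p : ℕ) : RamProg :=
  .seq (seqTo (loopReg s) (blockProg s p) s)
  (.seq (seqTo (loopReg s) (factorProg s p) (p * s))
    (RatExpr.assign (zeroReg s) (tmpArr s p) ⟨valueArr s p, zeroReg s⟩ (sumExpr s p p)))

/-- The memory during the computation: `δ` are the current digits, `δb` the best ones, and `β` is the
best value. -/
structure Base (s p W : ℕ) (σ₀ : RamState) (δ δb : ℕ → ℕ) (β : ℚ) (τ : RamState) : Prop where
  dim : ∀ j < s, τ.reg j = σ₀.reg j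
  zero : τ.reg (zeroReg s) = 0
  one : τ.reg (oneReg s) = 1
  three : τ.reg (threeReg s) = 3
  digit : ∀ u, τ.reg (digitReg s u) = δ u
  best : ∀ u, τ.reg (bestReg s u) = δb u
  digit_le : ∀ u, δ u ≤ W
  best_le : ∀ u, δb u ≤ W
  iarr : τ.iarr = σ₀.iarr
  arr : ∀ a < p * s, τ.arr a = σ₀.arr a
  signs : τ.arr (signArr s p) = signs
  value : τ.arr (bestArr s p) 0 = β

/-- Hypotheses on the input under which the program does not exceed its resources: `N` bounds the
dimensions of the blocks, and `2 ^ b` the coefficients and the partial sums of the factors. -/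
structure Admissible (s p N W b : ℕ) (σ₀ : RamState) : Prop where
  dim_le : ∀ j < s, σ₀.reg j ≤ N
  le : N + s + 3 ≤ W
  iarr_le : ∀ i j, σ₀.iarr i j ≤ 1
  arr : ∀ a k, RatBound b (σ₀.arr a k)
  factor : ∀ u < p * s, ∀ x : ℕ → ℚ, (∀ k, x k = 0 ∨ x k = 1) →
    ∀ l ≤ σ₀.reg (u % s), RatBound b (factor s σ₀ u x l)

/-- A bound for the weights of all expressions in the program. -/
def maxWeight (s p : ℕ) : ℕ :=
  ∑ j ∈ Finset.range s, (patternExpr s p j p (loopReg s)).weight + (sumExpr s p p).weight + 5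

/-! ### Correctness and cost of evaluating one candidate -/

variable {s p N W B b : ℕ} {σ₀ : RamState} {δ δb : ℕ → ℕ} {β : ℚ}

/-- For `Base`, the loop register and the arrays of outputs, factors, values and intermediate
results are scratch. -/
theorem Base.of_eq {τ τ' : RamState} (h : Base s p W σ₀ δ δb β τ)
    (hreg : ∀ r, r ≠ loopReg s → τ'.reg r = τ.reg r) (hi : τ'.iarr = τ.iarr)
    (harr : ∀ a, a < p * s ∨ a = bestArr s p ∨ a = signArr s p → τ'.arr a = τ.arr a) :
    Base s p W σ₀ δ δb β τ' where
  dim j hj := (hreg j (by grind)).trans (h.dim j hj)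
  zero := (hreg _ (by grind)).trans h.zero
  one := (hreg _ (by grind)).trans h.one
  three := (hreg _ (by grind)).trans h.three
  digit u := (hreg _ (by grind)).trans (h.digit u)
  best u := (hreg _ (by grind)).trans (h.best u)
  digit_le := h.digit_le
  best_le := h.best_le
  iarr := hi.trans h.iarr
  arr a ha := (harr a (Or.inl ha)).trans (h.arr a ha)
  signs := (harr _ (Or.inr (Or.inr rfl))).trans h.signs
  value := by rw [harr _ (Or.inr (Or.inl rfl)), h.value]

theorem ratBound_signs (b k : ℕ) : RatBound b (signs k) := by
  unfold signs
  rcases eq_or_ne k 2 with rfl | h2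
  · simpa using ratBound_neg_one b
  · rcases eq_or_ne k 1 with rfl | h1
    · simpa [Function.update] using ratBound_one b
    · simpa [Function.update, h1, h2] using ratBound_zero b

theorem reducedExpr_eval {τ : RamState} (h : Base s p W σ₀ δ δb β τ) {j : ℕ} (hj : j < s) {m : ℕ}
    (hm : m ≤ p) (r i : ℕ) (hi : i < p) :
    (reducedExpr s p j m r i).eval τ = reduced (fun l i => σ₀.arr (i * s + j) l)
      (fun m => δ (2 * (j * p + m))) m (τ.reg r) i := by
  induction m generalizing r i with
  | zero => simp only [reducedExpr, RatExpr.eval, RamState.read, reduced, h.arr _ (mul_add_lt hi hj)]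
  | succ m ih =>
    simp only [reducedExpr, RatExpr.eval, RatOp.eval, reduced]
    rw [ih (by omega) _ _ hi, ih (by omega) _ _ hi, ih (by omega) _ _ hm, ih (by omega) _ _ hm,
      h.digit]

theorem reducedExpr_bounded {τ : RamState} (h : Base s p W σ₀ δ δb β τ)
    (hA : Admissible s p N W b σ₀) {j : ℕ} (hj : j < s) {m : ℕ} (hm : m ≤ p) (r i : ℕ)
    (hi : i < p) : (reducedExpr s p j m r i).Bounded (tmpArr s p) b τ := by
  induction m generalizing r i with
  | zero =>
    have h1 := mul_add_lt hi hj
    refine ⟨by grind, ?_⟩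
    simp only [RamState.read, h.arr _ h1]
    exact hA.arr _ _
  | succ m ih =>
    exact ⟨ih (by omega) _ _ hi, ⟨ih (by omega) _ _ hm, ih (by omega) _ _ hm⟩,
      ih (by omega) _ _ hi⟩

theorem patternExpr_eval {τ : RamState} (h : Base s p W σ₀ δ δb β τ) {j : ℕ} (hj : j < s) {m : ℕ}
    (hm : m ≤ p) (r : ℕ) :
    (patternExpr s p j m r).eval τ = pattern (fun l i => σ₀.arr (i * s + j) l)
      (fun m => δ (2 * (j * p + m))) (fun m => AffineFBPO.signs (δ (2 * (j * p + m) + 1)))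
      m (τ.reg r) := by
  induction m with
  | zero => rfl
  | succ m ih =>
    simp only [patternExpr, signedExpr, RatExpr.eval, RatOp.eval, pattern, RamState.read]
    rw [ih (by omega), reducedExpr_eval h hj (by omega) _ _ hm, h.signs, h.digit]

theorem patternExpr_bounded {τ : RamState} (h : Base s p W σ₀ δ δb β τ)
    (hA : Admissible s p N W b σ₀) {j : ℕ} (hj : j < s) {m : ℕ} (hm : m ≤ p) (r : ℕ) :
    (patternExpr s p j m r).Bounded (tmpArr s p) b τ := by
  induction m with
  | zero => trivial
  | succ m ih =>
    have h1 : (signedExpr s p j m r).Bounded (tmpArr s p) b τ := by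
      refine ⟨⟨by grind, ?_⟩, reducedExpr_bounded h hA hj (by omega) _ _ hm⟩
      simp only [RamState.read, h.signs]
      exact ratBound_signs _ _
    exact ⟨ih (by omega), ⟨h1, h1⟩, h1, ih (by omega)⟩

theorem weight_patternExpr_le {j : ℕ} (hj : j < s) :
    (patternExpr s p j p (loopReg s)).weight ≤ maxWeight s p := by
  have := Finset.single_le_sum (f := fun j => (patternExpr s p j p (loopReg s)).weight)
    (fun _ _ => Nat.zero_le _) (Finset.mem_range.2 hj)
  unfold maxWeight
  omega

theorem size_bound {e : RatExpr} (hB : 2 * (maxWeight s p * (b + 1)) + 3 ≤ B)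
    (he : e.weight ≤ maxWeight s p) : 2 * (e.weight * (b + 1)) + 3 ≤ B := by
  have := Nat.mul_le_mul_right (b + 1) he
  omega

theorem ratSize_le_of_ratBound {q : ℚ} (hB : 2 * (maxWeight s p * (b + 1)) + 3 ≤ B)
    (h : RatBound b q) : ratSize q ≤ B := by
  have h1 := Nat.mul_le_mul_right (b + 1) (show 1 ≤ maxWeight s p by unfold maxWeight; omega)
  have := h.ratSize_le
  omega

theorem terminates_blockProg (hA : Admissible s p N W b σ₀)
    (hB : 2 * (maxWeight s p * (b + 1)) + 3 ≤ B) {σ : RamState} (hσ : Base s p W σ₀ δ δb β σ)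
    {j : ℕ} (hj : j < s) :
    Terminates W B (blockProg s p j) (N * (maxWeight s p + 5) + 2) σ fun τ =>
      Base s p W σ₀ δ δb β τ ∧
      (∀ a < bestArr s p, a ≠ outArr s p j → τ.arr a = σ.arr a) ∧
      ∀ k < σ₀.reg j, τ.arr (outArr s p j) k = candidate s p σ₀ δ j k := by
  have hn := hA.dim_le j hj
  have hW := hA.le
  have hw := weight_patternExpr_le (p := p) hj
  refine (terminates_forLoop (N := σ₀.reg j) (T := maxWeight s p + 3) (fun l τ =>
      (Base s p W σ₀ δ δb β τ ∧
      (∀ a < bestArr s p, a ≠ outArr s p j → τ.arr a = σ.arr a) ∧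
      ∀ k < l, τ.arr (outArr s p j) k = candidate s p σ₀ δ j k) ∧
      τ.reg (loopReg s) = l) ?_ (fun l τ h => h.2) (fun l τ h => h.1.1.dim j hj) ?_).mono ?_
      fun τ h => h.1
  · refine ⟨⟨hσ.of_eq (fun r hr => Function.update_of_ne hr _ _) rfl fun a _ => rfl,
      fun a _ _ => rfl, fun k hk => absurd hk (Nat.not_lt_zero k)⟩, ?_⟩
    simp [RamState.setReg]
  · rintro l hl τ ⟨⟨hτ, hfr, hout⟩, hreg⟩
    refine Terminates.mono (T := ((patternExpr s p j p (loopReg s)).weight + 1) + (1 + 1))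
      (Terminates.seq
      (RatExpr.terminates_assign
        (Q := fun ρ => Base s p W σ₀ δ δb β ρ ∧ (∀ a < bestArr s p, ρ.arr a = τ.arr a) ∧
          ρ.reg (loopReg s) = l ∧ ρ.arr (valueArr s p) 0 = (patternExpr s p j p (loopReg s)).eval τ)
        (patternExpr_bounded hτ hA hj le_rfl _) (size_bound hB hw) ?_)
      (T' := 1 + 1) (Q := _) ?_) (by omega) (fun _ h => h)
    · intro ρ h1 h2 h3 h4
      refine ⟨hτ.of_eq (fun r _ => by rw [h1]) h2 fun a ha => h3 a (by grind) (by grind),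
        fun a ha => h3 a (by grind) (by grind), by rw [h1, hreg], ?_⟩
      rw [h4 (by grind), hτ.zero]
      simp
    · rintro ρ ⟨h1, h2, h3, h4⟩
      -- Common to both branches: writing the right bit and incrementing the counter restores the
      -- invariant.
      have hfin : ∀ q : ℚ, candidate s p σ₀ δ j l = q → RatBound b q →
          Terminates W B (.instr (.ratConst ⟨outArr s p j, loopReg s⟩ q)) 1 ρ fun τ' =>
            τ'.reg (loopReg s) + τ'.reg (oneReg s) ≤ W ∧
            ((Base s p W σ₀ δ δb β (τ'.setReg (loopReg s)
                (τ'.reg (loopReg s) + τ'.reg (oneReg s))) ∧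
              (∀ a < bestArr s p, a ≠ outArr s p j → (τ'.setReg (loopReg s)
                (τ'.reg (loopReg s) + τ'.reg (oneReg s))).arr a = σ.arr a) ∧
              ∀ k < l + 1, (τ'.setReg (loopReg s)
                (τ'.reg (loopReg s) + τ'.reg (oneReg s))).arr (outArr s p j) k
                  = candidate s p σ₀ δ j k) ∧
              (τ'.setReg (loopReg s)
                (τ'.reg (loopReg s) + τ'.reg (oneReg s))).reg (loopReg s) = l + 1) := by
        intro q hq hqb
        refine terminates_instr (ratSize_le_of_ratBound hB hqb) ?_
        have e2 := h1.one
        simp only [RamInstr.run, RamState.write, RamState.setReg, h3, e2]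
        refine ⟨by omega, ⟨h1.of_eq (fun r hr => Function.update_of_ne hr _ _) rfl fun a ha =>
          Function.update_of_ne (by grind) _ _, fun a ha hne => ?_, fun k hk => ?_⟩, by simp⟩
        · rw [Function.update_of_ne hne, h2 a ha, hfr a ha hne]
        · rw [Function.update_self]
          rcases Nat.lt_succ_iff_lt_or_eq.1 hk with hk | rfl
          · rw [Function.update_of_ne hk.ne, h2 _ (by grind), hout k hk]
          · rw [Function.update_self, hq]
      have hval : ρ.read ⟨valueArr s p, zeroReg s⟩
          = pattern (fun l i => σ₀.arr (i * s + j) l) (fun m => δ (2 * (j * p + m)))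
            (fun m => signs (δ (2 * (j * p + m) + 1))) p l := by
        simp only [RamState.read]
        rw [h1.zero, h4, patternExpr_eval hτ hj le_rfl, hreg]
      have hzero : ρ.read ⟨signArr s p, zeroReg s⟩ = 0 := by
        simp only [RamState.read]
        rw [h1.zero, h1.signs]
        simp [signs, Function.update]
      refine terminates_ite (fun hb => hfin 1 ?_ (ratBound_one b))
        fun hb => hfin 0 ?_ (ratBound_zero b)
      · simp only [RamTest.Holds, hval, hzero] at hb
        simp only [candidate, if_pos hb]
      · simp only [RamTest.Holds, hval, hzero] at hb
        simp only [candidate, if_neg hb]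
  · have := Nat.mul_le_mul_right (maxWeight s p + 3 + 2) hn
    show 1 + (σ₀.reg j * (maxWeight s p + 3 + 2) + 1) ≤ N * (maxWeight s p + 3 + 2) + 2
    omega

/-- The summand `5` in `maxWeight` is the weight of `termExpr`. -/
theorem weight_termExpr_le (u : ℕ) : (termExpr s p u).weight ≤ maxWeight s p :=
  Nat.le_add_left 5 _

theorem terminates_factorProg (hA : Admissible s p N W b σ₀)
    (hB : 2 * (maxWeight s p * (b + 1)) + 3 ≤ B) {σ : RamState} (hσ : Base s p W σ₀ δ δb β σ)
    {x : ℕ → ℕ → ℚ} (hx : ∀ j k, x j k = 0 ∨ x j k = 1)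
    (hout : ∀ j < s, ∀ k < σ₀.reg j, σ.arr (outArr s p j) k = x j k)
    (hs : 0 < s) {u : ℕ} (hu : u < p * s) :
    Terminates W B (factorProg s p u) (N * (maxWeight s p + 5) + 6) σ fun τ =>
      Base s p W σ₀ δ δb β τ ∧
      (∀ a < valueArr s p, a ≠ factorArr s p u → τ.arr a = σ.arr a) ∧
      τ.arr (factorArr s p u) 0 = factor s σ₀ u (x (u % s)) (σ₀.reg (u % s)) := by
  have hj : u % s < s := Nat.mod_lt _ hs
  have hn := hA.dim_le _ hj
  have hW := hA.le
  have hf := hA.factor u hu (x (u % s)) (hx _)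
  have hpre : ∀ (σ' : RamState), Base s p W σ₀ δ δb β σ' → (∀ a, σ'.arr a = σ.arr a) →
      σ'.reg (loopReg s) = σ₀.iarr (u / s) (u % s) →
      Terminates W B (.ite (.intLt (zeroReg s) (loopReg s))
        (.instr (.ratCopy ⟨factorArr s p u, zeroReg s⟩ ⟨u, u % s⟩))
        (.instr (.ratConst ⟨factorArr s p u, zeroReg s⟩ 1))) (1 + 1) σ' fun τ =>
        Base s p W σ₀ δ δb β τ ∧
        (∀ a < valueArr s p, a ≠ factorArr s p u → τ.arr a = σ.arr a) ∧
        τ.arr (factorArr s p u) 0 = factor s σ₀ u (x (u % s)) 0 := by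
    intro σ' h1 h2 h3
    have hq : ∀ q : ℚ, Base s p W σ₀ δ δb β (σ'.write ⟨factorArr s p u, zeroReg s⟩ q) ∧
        (∀ a < valueArr s p, a ≠ factorArr s p u →
          (σ'.write ⟨factorArr s p u, zeroReg s⟩ q).arr a = σ.arr a) ∧
        (σ'.write ⟨factorArr s p u, zeroReg s⟩ q).arr (factorArr s p u) 0 = q := by
      intro q
      refine ⟨h1.of_eq (fun _ _ => rfl) rfl fun a ha => Function.update_of_ne (by grind) _ _,
        fun a _ hne => ?_, ?_⟩
      · rw [← h2 a]
        exact Function.update_of_ne hne _ _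
      · simp only [RamState.write, h1.zero]
        simp
    have hread : σ'.read ⟨u, u % s⟩ = σ₀.arr u (σ₀.reg (u % s)) := by
      simp only [RamState.read, h1.arr u hu, h1.dim _ hj]
    refine terminates_ite (fun hb => ?_) fun hb => ?_
    · simp only [RamTest.Holds, h1.zero, h3] at hb
      refine terminates_instr ?_ ?_
      · simp only [RamInstr.Fits, hread]
        exact ratSize_le_of_ratBound hB (hA.arr _ _)
      · simpa [RamInstr.run, factor, hb, hread] using hq (σ'.read ⟨u, u % s⟩)
    · simp only [RamTest.Holds, h1.zero, h3] at hb
      refine terminates_instr (ratSize_le_of_ratBound hB (ratBound_one b)) ?_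
      simpa [RamInstr.run, factor, hb] using hq 1
  have hloop : ∀ σ' : RamState, Base s p W σ₀ δ δb β σ' ∧
      (∀ a < valueArr s p, a ≠ factorArr s p u → σ'.arr a = σ.arr a) ∧
      σ'.arr (factorArr s p u) 0 = factor s σ₀ u (x (u % s)) 0 →
      Terminates W B (forLoop (oneReg s) (loopReg s) (u % s)
        (RatExpr.assign (zeroReg s) (tmpArr s p) ⟨factorArr s p u, zeroReg s⟩ (termExpr s p u)))
        (N * (maxWeight s p + 5) + 2) σ' fun τ => Base s p W σ₀ δ δb β τ ∧
      (∀ a < valueArr s p, a ≠ factorArr s p u → τ.arr a = σ.arr a) ∧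
      τ.arr (factorArr s p u) 0 = factor s σ₀ u (x (u % s)) (σ₀.reg (u % s)) := by
    rintro σ' ⟨h1, h2, h3⟩
    refine (terminates_forLoop (N := σ₀.reg (u % s)) (T := maxWeight s p + 3) (fun l τ =>
      (Base s p W σ₀ δ δb β τ ∧
      (∀ a < valueArr s p, a ≠ factorArr s p u → τ.arr a = σ.arr a) ∧
      τ.arr (factorArr s p u) 0 = factor s σ₀ u (x (u % s)) l) ∧
      τ.reg (loopReg s) = l) ?_ (fun l τ h => h.2) (fun l τ h => h.1.1.dim _ hj) ?_).mono ?_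
      fun τ h => h.1
    · refine ⟨⟨h1.of_eq (fun r hr => Function.update_of_ne hr _ _) rfl fun a _ => rfl, h2, h3⟩, ?_⟩
      simp [RamState.setReg]
    · rintro l hl τ ⟨⟨hτ, hfr, hval⟩, hreg⟩
      have hx' : τ.arr (outArr s p (u % s)) l = x (u % s) l := by
        rw [hfr _ (by grind) (by grind), hout _ hj l hl]
      have hbd : (termExpr s p u).Bounded (tmpArr s p) b τ := by
        refine ⟨⟨by grind, ?_⟩, ⟨by grind, ?_⟩, by grind, ?_⟩
        · simp only [RamState.read, hτ.zero, hval]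
          exact hf l hl.le
        · simp only [RamState.read, hτ.arr _ hu]
          exact hA.arr _ _
        · simp only [RamState.read, hreg, hx']
          rcases hx (u % s) l with h | h <;> rw [h]
          exacts [ratBound_zero b, ratBound_one b]
      refine (RatExpr.terminates_assign hbd (size_bound hB (weight_termExpr_le u)) ?_).mono
        (by have := weight_termExpr_le (s := s) (p := p) u; omega) fun _ h => h
      · intro ρ e1 e2 e3 e4
        have e5 := e4 (by grind)
        have hone : ρ.reg (oneReg s) = 1 := by rw [e1, hτ.one]
        have hl' : ρ.reg (loopReg s) = l := by rw [e1, hreg]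
        simp only [hone, hl']
        refine ⟨by omega, ⟨hτ.of_eq (fun r hr => ?_) e2 fun a ha => ?_, fun a ha hne => ?_, ?_⟩, ?_⟩
        · rw [← e1]
          exact Function.update_of_ne hr _ _
        · exact e3 a (by grind) (by grind)
        · rw [← hfr a ha hne]
          exact e3 a (by grind) hne
        · show ρ.arr (factorArr s p u) 0 = _
          rw [e5, hτ.zero, Function.update_self]
          simp only [termExpr, RatExpr.eval, RatOp.eval, RamState.read, hτ.zero, hreg, hx',
            hτ.arr _ hu]
          rw [hval]
          simp only [factor, Finset.sum_range_succ]
          ring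
        · simp [RamState.setReg]
    · have := Nat.mul_le_mul_right (maxWeight s p + 3 + 2) hn
      show 1 + (σ₀.reg (u % s) * (maxWeight s p + 3 + 2) + 1) ≤ N * (maxWeight s p + 3 + 2) + 2
      omega
  refine Terminates.mono (T := 1 + (1 + ((1 + 1) + (N * (maxWeight s p + 5) + 2))))
    (Terminates.seq (Q := fun τ => τ = σ.setReg (loopReg s) (u % s))
      (terminates_instr (i := .const (loopReg s) (u % s)) (by show u % s ≤ W; omega) rfl) ?_)
    (by omega) fun _ h => h
  rintro _ rfl
  refine Terminates.seq (Q := fun τ => τ = (σ.setReg (loopReg s) (u % s)).setReg (loopReg s)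
    (σ₀.iarr (u / s) (u % s))) (terminates_instr ?_ ?_) ?_
  · simp only [RamInstr.Fits, RamState.setReg, hσ.iarr]
    have := hA.iarr_le (u / s) (Function.update σ.reg (loopReg s) (u % s) (loopReg s))
    omega
  · simp [RamInstr.run, RamState.setReg, hσ.iarr]
  · rintro _ rfl
    refine Terminates.seq (hpre _ (hσ.of_eq (fun r hr => ?_) rfl fun a _ => rfl) (fun a => rfl)
      ?_) hloop
    · simp only [RamState.setReg]
      rw [Function.update_of_ne hr, Function.update_of_ne hr]
    · simp [RamState.setReg]

theorem prodExpr_spec {τ : RamState} {f : ℕ → ℚ} (hz : τ.reg (zeroReg s) = 0)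
    (hf : ∀ u < p * s, τ.arr (factorArr s p u) 0 = f u)
    (hb : ∀ u < p * s, RatBound b (f u)) {i : ℕ} (hi : i < p) {j : ℕ} (hj : j ≤ s) :
    (prodExpr s p i j).eval τ = ∏ j ∈ Finset.range j, f (i * s + j) ∧
      (prodExpr s p i j).Bounded (tmpArr s p) b τ := by
  induction j with
  | zero => exact ⟨rfl, trivial⟩
  | succ j ih =>
    obtain ⟨h1, h2⟩ := ih (by omega)
    have h3 := mul_add_lt hi hj
    have h4 : τ.read ⟨factorArr s p (i * s + j), zeroReg s⟩ = f (i * s + j) := by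
      simp only [RamState.read, hz, hf _ h3]
    exact ⟨by simp only [prodExpr, RatExpr.eval, RatOp.eval, h1, h4, Finset.prod_range_succ],
      h2, by grind, h4 ▸ hb _ h3⟩

theorem sumExpr_spec {τ : RamState} {f : ℕ → ℚ} (hz : τ.reg (zeroReg s) = 0)
    (hf : ∀ u < p * s, τ.arr (factorArr s p u) 0 = f u)
    (hb : ∀ u < p * s, RatBound b (f u)) {i : ℕ} (hi : i ≤ p) :
    (sumExpr s p i).eval τ = ∑ i ∈ Finset.range i, ∏ j ∈ Finset.range s, f (i * s + j) ∧
      (sumExpr s p i).Bounded (tmpArr s p) b τ := by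
  induction i with
  | zero => exact ⟨rfl, trivial⟩
  | succ i ih =>
    obtain ⟨h1, h2⟩ := ih (by omega)
    obtain ⟨h3, h4⟩ := prodExpr_spec hz hf hb hi le_rfl
    exact ⟨by simp only [sumExpr, RatExpr.eval, RatOp.eval, h1, h3, Finset.sum_range_succ], h2, h4⟩

/-- The number of steps of `evalProg`. -/
def evalTime (s p N : ℕ) : ℕ :=
  (s + p * s) * (N * (maxWeight s p + 5) + 6) + maxWeight s p + 3

theorem terminates_evalProg (hs : 0 < s) (hA : Admissible s p N W b σ₀)
    (hB : 2 * (maxWeight s p * (b + 1)) + 3 ≤ B) {σ : RamState}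
    (hσ : Base s p W σ₀ δ δb β σ) :
    Terminates W B (evalProg s p) (evalTime s p N) σ fun τ =>
      Base s p W σ₀ δ δb β τ ∧
      ratSize (value s p σ₀ (candidate s p σ₀ δ)) ≤ B ∧
      τ.arr (valueArr s p) 0 = value s p σ₀ (candidate s p σ₀ δ) ∧
      ∀ j < s, ∀ k < σ₀.reg j, τ.arr (outArr s p j) k = candidate s p σ₀ δ j k := by
  have hclear : ∀ τ, Base s p W σ₀ δ δb β τ → Base s p W σ₀ δ δb β (τ.setReg (loopReg s) 0) :=
    fun τ hτ => hτ.of_eq (fun r hr => Function.update_of_ne hr _ _) rfl fun a _ => rfl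
  have h1 := terminates_seqTo (W := W) (B := B) (r := loopReg s) (f := blockProg s p) (σ := σ)
    (T := N * (maxWeight s p + 5) + 2) (fun m τ => Base s p W σ₀ δ δb β τ ∧
      ∀ j < m, ∀ k < σ₀.reg j, τ.arr (outArr s p j) k = candidate s p σ₀ δ j k)
    ⟨hclear σ hσ, fun j hj => absurd hj (Nat.not_lt_zero j)⟩ s fun j hj τ hτ =>
      (terminates_blockProg hA hB hτ.1 hj).mono le_rfl fun ρ hρ => ⟨hρ.1, fun i hi k hk => by
        rcases Nat.lt_succ_iff_lt_or_eq.1 hi with hi | rfl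
        · rw [hρ.2.1 _ (by grind) (by grind), hτ.2 i hi k hk]
        · exact hρ.2.2 k hk⟩
  refine Terminates.mono (T := (s * (N * (maxWeight s p + 5) + 2) + 1)
    + ((p * s * (N * (maxWeight s p + 5) + 6) + 1) + (maxWeight s p + 1)))
    (h1.seq fun τ hτ => Terminates.seq (terminates_seqTo (fun m τ => Base s p W σ₀ δ δb β τ ∧
      (∀ j < s, ∀ k < σ₀.reg j, τ.arr (outArr s p j) k = candidate s p σ₀ δ j k) ∧
      ∀ u < m, τ.arr (factorArr s p u) 0
        = factor s σ₀ u (candidate s p σ₀ δ (u % s)) (σ₀.reg (u % s)))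
      ⟨hclear τ hτ.1, hτ.2, fun u hu => absurd hu (Nat.not_lt_zero u)⟩ (p * s)
      fun u hu ρ hρ => (terminates_factorProg hA hB hρ.1 (candidate_eq s p σ₀ δ) hρ.2.1 hs hu).mono le_rfl
        fun ρ' hρ' => ⟨hρ'.1, fun j hj k hk => ?_, fun v hv => ?_⟩) fun ρ hρ => ?_) ?_ fun _ h => h
  · rw [hρ'.2.1 _ (by grind) (by grind), hρ.2.1 j hj k hk]
  · rcases Nat.lt_succ_iff_lt_or_eq.1 hv with hv | rfl
    · rw [hρ'.2.1 _ (by grind) (by grind), hρ.2.2 v hv]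
    · exact hρ'.2.2
  · have hw : (sumExpr s p p).weight ≤ maxWeight s p := by unfold maxWeight; omega
    obtain ⟨e1, e2⟩ := sumExpr_spec hρ.1.zero hρ.2.2
      (fun u hu => hA.factor u hu _ (candidate_eq s p σ₀ δ _) _ le_rfl) le_rfl
    have e3 : (sumExpr s p p).eval ρ = value s p σ₀ (candidate s p σ₀ δ) := by
      rw [e1]
      refine Finset.sum_congr rfl fun i _ => Finset.prod_congr rfl fun j hj => ?_
      rw [Nat.mul_add_mod_of_lt (Finset.mem_range.1 hj)]
    refine (RatExpr.terminates_assign e2 (size_bound hB hw) fun ρ' g1 g2 g3 g4 =>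
      ⟨hρ.1.of_eq (fun r _ => by rw [g1]) g2 fun a ha => g3 a (by grind) (by grind), ?_, ?_,
        fun j hj k hk => ?_⟩).mono (by omega) fun _ h => h
    · rw [← e3]
      exact e2.ratBound.ratSize_le.trans (size_bound hB hw)
    · rw [g4 (by grind), hρ.1.zero, Function.update_self, e3]
    · rw [g3 _ (by grind) (by grind), hρ.2.1 j hj k hk]
  · unfold evalTime
    have e1 : (s + p * s) * (N * (maxWeight s p + 5) + 6)
      = s * (N * (maxWeight s p + 5) + 2) + p * s * (N * (maxWeight s p + 5) + 6) + s * 4 := by ring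
    omega

end AffineFBPO

namespace AffineFBPO

variable {s p N W B b : ℕ} {σ₀ : RamState} {δ δb : ℕ → ℕ} {β : ℚ}

/-! ### Enumeration of the candidates -/

def saveProg (s p : ℕ) : RamProg :=
  seqTo (loopReg s) (fun u => .instr (.intOp .add (bestReg s u) (digitReg s u) (zeroReg s)))
    (2 * (s * p))

def restoreProg (s p : ℕ) : RamProg :=
  seqTo (loopReg s) (fun u => .instr (.intOp .add (digitReg s u) (bestReg s u) (zeroReg s)))
    (2 * (s * p))

def updateProg (s p : ℕ) : RamProg :=
  .seq (evalProg s p)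
    (.ite (.ratLt ⟨bestArr s p, zeroReg s⟩ ⟨valueArr s p, zeroReg s⟩)
      (.seq (.instr (.ratCopy ⟨bestArr s p, zeroReg s⟩ ⟨valueArr s p, zeroReg s⟩)) (saveProg s p))
      (.instr (.const (loopReg s) 0)))

/-- The register which holds the bound for digit `v`. -/
def boundReg (s p v : ℕ) : ℕ :=
  if v % 2 = 0 then v / 2 / p else threeReg s

/-- The bound for digit `v`. -/
def digitBound (p : ℕ) (σ₀ : RamState) (v : ℕ) : ℕ :=
  if v % 2 = 0 then σ₀.reg (v / 2 / p) else 3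

def nestProg (s p : ℕ) : ℕ → RamProg
  | 0 => updateProg s p
  | v + 1 => forLoop (oneReg s) (digitReg s v) (boundReg s p v) (nestProg s p v)

def setupProg (s p : ℕ) : RamProg :=
  .seq (.instr (.const (oneReg s) 1))
  (.seq (.instr (.const (threeReg s) 3))
  (.seq (.instr (.const (loopReg s) 2))
  (.seq (.instr (.ratConst ⟨signArr s p, oneReg s⟩ 1))
    (.instr (.ratConst ⟨signArr s p, loopReg s⟩ (-1))))))

def mainProg (s p : ℕ) : RamProg :=
  .seq (setupProg s p)
  -- The all-zero string is evaluated first, so that the best value is always attained by the stored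
  -- digits; a start at `0` would fail for negative optima.
  (.seq (.seq (evalProg s p) (.instr (.ratCopy ⟨bestArr s p, zeroReg s⟩ ⟨valueArr s p, zeroReg s⟩)))
  (.seq (nestProg s p (2 * (s * p)))
  -- Only digits are saved during the search; the solution itself is recomputed here.
  (.seq (restoreProg s p) (evalProg s p))))

def nestTime (s p N : ℕ) : ℕ → ℕ
  | 0 => evalTime s p N + (2 * (s * p) + 3)
  | v + 1 => (N + 3) * (nestTime s p N v + 2) + 2

def mainTime (s p N : ℕ) : ℕ :=
  5 + ((evalTime s p N + 1)
    + (nestTime s p N (2 * (s * p)) + ((2 * (s * p) * 1 + 1) + evalTime s p N)))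

theorem Base.clear {τ : RamState} (h : Base s p W σ₀ δ δb β τ) (x : ℕ) :
    Base s p W σ₀ δ δb β (τ.setReg (loopReg s) x) :=
  h.of_eq (fun _ hr => Function.update_of_ne hr _ _) rfl fun _ _ => rfl

theorem update_injective_apply {f : ℕ → ℕ} (hf : Function.Injective f) (g : ℕ → ℕ) (v x u : ℕ) :
    Function.update g (f v) x (f u) = Function.update (fun u => g (f u)) v x u := by
  simp only [Function.update_apply, hf.eq_iff]

theorem update_le {f : ℕ → ℕ} (hf : ∀ u, f u ≤ W) (v : ℕ) {x : ℕ} (hx : x ≤ W) (u : ℕ) :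
    Function.update f v x u ≤ W := by
  rw [Function.update_apply]
  split_ifs
  exacts [hx, hf u]

theorem Base.setDigit {τ : RamState} (h : Base s p W σ₀ δ δb β τ) (v : ℕ) {x : ℕ} (hx : x ≤ W) :
    Base s p W σ₀ (Function.update δ v x) δb β (τ.setReg (digitReg s v) x) where
  dim j hj := (Function.update_of_ne (by grind) _ _).trans (h.dim j hj)
  zero := (Function.update_of_ne (by grind) _ _).trans h.zero
  one := (Function.update_of_ne (by grind) _ _).trans h.one
  three := (Function.update_of_ne (by grind) _ _).trans h.three
  digit u := by
    rw [← funext h.digit]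
    exact update_injective_apply (f := digitReg s) (fun a b hab => by grind) τ.reg v x u
  best u := (Function.update_of_ne (by grind) _ _).trans (h.best u)
  digit_le := update_le h.digit_le v hx
  best_le := h.best_le
  iarr := h.iarr
  arr := h.arr
  signs := h.signs
  value := h.value

theorem Base.setBest {τ : RamState} (h : Base s p W σ₀ δ δb β τ) (v : ℕ) {x : ℕ} (hx : x ≤ W) :
    Base s p W σ₀ δ (Function.update δb v x) β (τ.setReg (bestReg s v) x) where
  dim j hj := (Function.update_of_ne (by grind) _ _).trans (h.dim j hj)
  zero := (Function.update_of_ne (by grind) _ _).trans h.zero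
  one := (Function.update_of_ne (by grind) _ _).trans h.one
  three := (Function.update_of_ne (by grind) _ _).trans h.three
  digit u := (Function.update_of_ne (by grind) _ _).trans (h.digit u)
  best u := by
    rw [← funext h.best]
    exact update_injective_apply (f := bestReg s) (fun a b hab => by grind) τ.reg v x u
  digit_le := h.digit_le
  best_le := update_le h.best_le v hx
  iarr := h.iarr
  arr := h.arr
  signs := h.signs
  value := h.value

theorem Base.setValue {τ : RamState} (h : Base s p W σ₀ δ δb β τ) (q : ℚ) :
    Base s p W σ₀ δ δb q (τ.write ⟨bestArr s p, zeroReg s⟩ q) where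
  dim := h.dim
  zero := h.zero
  one := h.one
  three := h.three
  digit := h.digit
  best := h.best
  digit_le := h.digit_le
  best_le := h.best_le
  iarr := h.iarr
  arr a ha := (Function.update_of_ne (by grind) _ _).trans (h.arr a ha)
  signs := (Function.update_of_ne (by grind) _ _).trans h.signs
  value := by
    simp only [RamState.write, h.zero]
    simp

theorem terminates_saveProg {σ : RamState} (hσ : Base s p W σ₀ δ δb β σ) :
    Terminates W B (saveProg s p) (2 * (s * p) * 1 + 1) σ fun τ =>
      ∃ δb', Base s p W σ₀ δ δb' β τ ∧ ∀ u < 2 * (s * p), δb' u = δ u := by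
  refine terminates_seqTo (fun m τ => ∃ δb', Base s p W σ₀ δ δb' β τ ∧ ∀ u < m, δb' u = δ u)
    ⟨δb, hσ.clear 0, fun u hu => absurd hu (Nat.not_lt_zero u)⟩ _ ?_
  rintro l - τ ⟨δ', h1, h2⟩
  have h3 : IntOp.eval .add (τ.reg (digitReg s l)) (τ.reg (zeroReg s)) = δ l := by
    simp only [IntOp.eval, h1.digit, h1.zero, add_zero]
  refine terminates_instr ?_ ⟨Function.update δ' l (δ l), ?_, fun u hu => ?_⟩
  · simp only [RamInstr.Fits, h3]
    exact h1.digit_le l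
  · simp only [RamInstr.run, h3]
    exact h1.setBest l (h1.digit_le l)
  · rcases Nat.lt_succ_iff_lt_or_eq.1 hu with hu | rfl
    · rw [Function.update_of_ne hu.ne, h2 u hu]
    · rw [Function.update_self]

theorem terminates_restoreProg {σ : RamState} (hσ : Base s p W σ₀ δ δb β σ) :
    Terminates W B (restoreProg s p) (2 * (s * p) * 1 + 1) σ fun τ =>
      ∃ δ', Base s p W σ₀ δ' δb β τ ∧ ∀ u < 2 * (s * p), δ' u = δb u := by
  refine terminates_seqTo (fun m τ => ∃ δ', Base s p W σ₀ δ' δb β τ ∧ ∀ u < m, δ' u = δb u)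
    ⟨δ, hσ.clear 0, fun u hu => absurd hu (Nat.not_lt_zero u)⟩ _ ?_
  rintro l - τ ⟨δ', h1, h2⟩
  have h3 : IntOp.eval .add (τ.reg (bestReg s l)) (τ.reg (zeroReg s)) = δb l := by
    simp only [IntOp.eval, h1.best, h1.zero, add_zero]
  refine terminates_instr ?_ ⟨Function.update δ' l (δb l), ?_, fun u hu => ?_⟩
  · simp only [RamInstr.Fits, h3]
    exact h1.best_le l
  · simp only [RamInstr.run, h3]
    exact h1.setDigit l (h1.best_le l)
  · rcases Nat.lt_succ_iff_lt_or_eq.1 hu with hu | rfl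
    · rw [Function.update_of_ne hu.ne, h2 u hu]
    · rw [Function.update_self]

theorem terminates_updateProg (hs : 0 < s) (hA : Admissible s p N W b σ₀)
    (hB : 2 * (maxWeight s p * (b + 1)) + 3 ≤ B) {σ : RamState}
    (hσ : Base s p W σ₀ δ δb (value s p σ₀ (candidate s p σ₀ δb)) σ) :
    Terminates W B (updateProg s p) (nestTime s p N 0) σ fun τ => ∃ δb',
      Base s p W σ₀ δ δb' (value s p σ₀ (candidate s p σ₀ δb')) τ ∧
      value s p σ₀ (candidate s p σ₀ δb) ≤ value s p σ₀ (candidate s p σ₀ δb') ∧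
      value s p σ₀ (candidate s p σ₀ δ) ≤ value s p σ₀ (candidate s p σ₀ δb') := by
  refine (terminates_evalProg hs hA hB hσ).seq fun τ hτ => ?_
  obtain ⟨h1, h2, h3, -⟩ := hτ
  have hv : τ.read ⟨valueArr s p, zeroReg s⟩ = value s p σ₀ (candidate s p σ₀ δ) := by
    simp only [RamState.read]
    rw [h1.zero, h3]
  have hb : τ.read ⟨bestArr s p, zeroReg s⟩ = value s p σ₀ (candidate s p σ₀ δb) := by
    simp only [RamState.read]
    rw [h1.zero, h1.value]
  refine (terminates_ite (T := 1 + (2 * (s * p) * 1 + 1)) (fun h => ?_) fun h => ?_).mono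
    (by omega) fun _ h => h
  · simp only [RamTest.Holds, hv, hb] at h
    refine Terminates.seq (Q := fun ρ => ρ = τ.write ⟨bestArr s p, zeroReg s⟩
      (value s p σ₀ (candidate s p σ₀ δ))) (terminates_instr ?_ ?_) ?_
    · simpa only [RamInstr.Fits, hv] using h2
    · simp only [RamInstr.run, hv]
    · rintro _ rfl
      refine (terminates_saveProg (h1.setValue _)).mono le_rfl ?_
      rintro ρ ⟨δ', g1, g2⟩
      have e := value_candidate_congr (σ₀ := σ₀) g2
      exact ⟨δ', e ▸ g1, e ▸ h.le, e.ge⟩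
  · simp only [RamTest.Holds, hv, hb, not_lt] at h
    exact (terminates_instr (i := .const (loopReg s) 0) (Nat.zero_le W)
      ⟨δb, h1.clear 0, le_rfl, h⟩).mono (by omega) fun _ h => h

theorem div_div_lt {v : ℕ} (hv : v < 2 * (s * p)) : v / 2 / p < s :=
  Nat.div_lt_of_lt_mul (by rw [mul_comm]; omega)

theorem digitBound_le (hA : Admissible s p N W b σ₀) {v : ℕ} (hv : v < 2 * (s * p)) :
    digitBound p σ₀ v ≤ N + 3 := by
  unfold digitBound
  split_ifs
  · exact (hA.dim_le _ (div_div_lt hv)).trans (Nat.le_add_right N 3)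
  · exact Nat.le_add_left 3 N

theorem Base.bound {τ : RamState} (h : Base s p W σ₀ δ δb β τ) {v : ℕ}
    (hv : v < 2 * (s * p)) : τ.reg (boundReg s p v) = digitBound p σ₀ v := by
  unfold boundReg digitBound
  split_ifs
  exacts [h.dim _ (div_div_lt hv), h.three]

/-- Digits from `v` on are fixed by the outer loops, and the best value dominates all completions
below `v`. The loop over digit `v` adds to its invariant the condition `ε v < l` on the strings
already covered. -/
theorem terminates_nestProg (hs : 0 < s) (hA : Admissible s p N W b σ₀)
    (hB : 2 * (maxWeight s p * (b + 1)) + 3 ≤ B) (v : ℕ) (hv : v ≤ 2 * (s * p)) {δ δb : ℕ → ℕ}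
    {σ : RamState} (hσ : Base s p W σ₀ δ δb (value s p σ₀ (candidate s p σ₀ δb)) σ) :
    Terminates W B (nestProg s p v) (nestTime s p N v) σ fun τ => ∃ δ' δb',
      Base s p W σ₀ δ' δb' (value s p σ₀ (candidate s p σ₀ δb')) τ ∧
      (∀ u, v ≤ u → δ' u = δ u) ∧
      value s p σ₀ (candidate s p σ₀ δb) ≤ value s p σ₀ (candidate s p σ₀ δb') ∧
      ∀ ε : ℕ → ℕ, (∀ u, v ≤ u → ε u = δ u) → (∀ u < v, ε u < digitBound p σ₀ u) →
        value s p σ₀ (candidate s p σ₀ ε) ≤ value s p σ₀ (candidate s p σ₀ δb') := by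
  induction v generalizing δ δb σ with
  | zero =>
    refine (terminates_updateProg hs hA hB hσ).mono le_rfl ?_
    rintro τ ⟨δb', h1, h2, h3⟩
    refine ⟨δ, δb', h1, fun _ _ => rfl, h2, fun ε hε _ => ?_⟩
    rwa [show ε = δ from funext fun u => hε u (Nat.zero_le u)]
  | succ v ih =>
    have hN := digitBound_le hA hv
    have hW := hA.le
    refine (terminates_forLoop (N := digitBound p σ₀ v) (T := nestTime s p N v)
      (fun l τ => ∃ δ' δb',
        Base s p W σ₀ δ' δb' (value s p σ₀ (candidate s p σ₀ δb')) τ ∧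
        (∀ u, v + 1 ≤ u → δ' u = δ u) ∧ δ' v = l ∧
        value s p σ₀ (candidate s p σ₀ δb) ≤ value s p σ₀ (candidate s p σ₀ δb') ∧
        ∀ ε : ℕ → ℕ, (∀ u, v + 1 ≤ u → ε u = δ u) → (∀ u < v, ε u < digitBound p σ₀ u) →
          ε v < l → value s p σ₀ (candidate s p σ₀ ε) ≤ value s p σ₀ (candidate s p σ₀ δb'))
      ?_ ?_ ?_ ?_).mono ?_ ?_
    · exact ⟨Function.update δ v 0, δb, hσ.setDigit v (Nat.zero_le W),
        fun u hu => Function.update_of_ne (by omega) _ _, Function.update_self _ _ _, le_rfl,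
        fun ε _ _ h => absurd h (Nat.not_lt_zero _)⟩
    · rintro l τ ⟨δ', δb', h, -, h2, -⟩
      rw [h.digit, h2]
    · rintro l τ ⟨δ', δb', h, -⟩
      exact h.bound hv
    · rintro l hl τ ⟨δ₁, δb₁, h1, h2, h3, h4, h5⟩
      refine (ih (by omega) h1).mono le_rfl ?_
      rintro ρ ⟨δ₂, δb₂, g1, g2, g3, g4⟩
      have hd : ρ.reg (digitReg s v) + ρ.reg (oneReg s) = l + 1 := by
        rw [g1.digit, g2 v le_rfl, h3, g1.one]
      rw [hd]
      refine ⟨by omega, Function.update δ₂ v (l + 1), δb₂, g1.setDigit v (by omega),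
        fun u hu => ?_, Function.update_self _ _ _, h4.trans g3, fun ε e1 e2 e3 => ?_⟩
      · rw [Function.update_of_ne (by omega), g2 u (by omega), h2 u hu]
      · rcases Nat.lt_succ_iff_lt_or_eq.1 e3 with e3 | e3
        · exact (h5 ε e1 e2 e3).trans g3
        · refine g4 ε (fun u hu => ?_) e2
          rcases Nat.eq_or_lt_of_le hu with rfl | hu
          · rw [e3, h3]
          · rw [e1 u hu, h2 u hu]
    · have := Nat.mul_le_mul_right (nestTime s p N v + 2) hN
      show _ ≤ (N + 3) * (nestTime s p N v + 2) + 2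
      omega
    · rintro τ ⟨δ', δb', h1, h2, -, h4, h5⟩
      exact ⟨δ', δb', h1, h2, h4, fun ε e1 e2 =>
        h5 ε e1 (fun u hu => e2 u (by omega)) (e2 v (Nat.lt_succ_self v))⟩

theorem terminates_setupProg (hA : Admissible s p N W b σ₀)
    (hB : 2 * (maxWeight s p * (b + 1)) + 3 ≤ B) (hreg : ∀ r, s ≤ r → σ₀.reg r = 0)
    (harr : ∀ a k, p * s ≤ a → σ₀.arr a k = 0) :
    Terminates W B (setupProg s p) 5 σ₀ (Base s p W σ₀ (fun _ => 0) (fun _ => 0) 0) := by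
  have hW := hA.le
  have h1 := ratSize_le_of_ratBound hB (ratBound_one b)
  have h2 := ratSize_le_of_ratBound hB (ratBound_neg_one b)
  refine ⟨_, _, .seq (.instr _ _ ?_) (.seq (.instr _ _ ?_) (.seq (.instr _ _ ?_)
    (.seq (.instr _ _ ?_) (.instr _ _ ?_)))), le_rfl, ?_⟩
  · show 1 ≤ W
    omega
  · show 3 ≤ W
    omega
  · show 2 ≤ W
    omega
  · exact h1
  · exact h2
  · have hz : ∀ r, s + 4 ≤ r ∨ r = s → Function.update (Function.update (Function.update σ₀.reg
        (oneReg s) 1) (threeReg s) 3) (loopReg s) 2 r = 0 := fun r hr => by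
      rw [Function.update_of_ne (by grind), Function.update_of_ne (by grind),
        Function.update_of_ne (by grind), hreg r (by omega)]
    constructor
    · intro j hj
      simp only [RamInstr.run, RamState.write, RamState.setReg]
      rw [Function.update_of_ne (by grind), Function.update_of_ne (by grind),
        Function.update_of_ne (by grind)]
    · exact hz _ (Or.inr rfl)
    · simp [RamInstr.run, RamState.write, RamState.setReg]
    · simp [RamInstr.run, RamState.write, RamState.setReg]
    · exact fun u => hz _ (by grind)
    · exact fun u => hz _ (by grind)
    · exact fun u => Nat.zero_le W
    · exact fun u => Nat.zero_le W
    · rfl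
    · intro a ha
      simp only [RamInstr.run, RamState.write, RamState.setReg]
      rw [Function.update_of_ne (by grind), Function.update_of_ne (by grind)]
    · have h0 : σ₀.arr (signArr s p) = fun _ => 0 := funext fun k => harr _ k (by grind)
      simp [RamInstr.run, RamState.write, RamState.setReg, signs, h0]
    · simp only [RamInstr.run, RamState.write, RamState.setReg]
      rw [Function.update_of_ne (by grind), Function.update_of_ne (by grind),
        harr _ _ (by grind)]

theorem terminates_mainProg (hs : 0 < s) (hA : Admissible s p N W b σ₀)
    (hB : 2 * (maxWeight s p * (b + 1)) + 3 ≤ B) (hreg : ∀ r, s ≤ r → σ₀.reg r = 0)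
    (harr : ∀ a k, p * s ≤ a → σ₀.arr a k = 0) :
    Terminates W B (mainProg s p) (mainTime s p N) σ₀ fun τ => ∃ δ : ℕ → ℕ,
      (∀ j < s, ∀ k < σ₀.reg j, τ.arr (outArr s p j) k = candidate s p σ₀ δ j k) ∧
      ∀ ε : ℕ → ℕ, (∀ u < 2 * (s * p), ε u < digitBound p σ₀ u) →
        value s p σ₀ (candidate s p σ₀ ε) ≤ value s p σ₀ (candidate s p σ₀ δ) := by
  refine (terminates_setupProg hA hB hreg harr).seq fun τ hτ => ?_
  refine Terminates.seq (Q := Base s p W σ₀ (fun _ => 0) (fun _ => 0)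
    (value s p σ₀ (candidate s p σ₀ fun _ => 0)))
    ((terminates_evalProg hs hA hB hτ).seq fun ρ hρ => ?_) fun τ hτ => ?_
  · have hv : ρ.read ⟨valueArr s p, zeroReg s⟩
        = value s p σ₀ (candidate s p σ₀ fun _ => 0) := by
      simp only [RamState.read]
      rw [hρ.1.zero, hρ.2.2.1]
    refine terminates_instr ?_ ?_
    · simpa only [RamInstr.Fits, hv] using hρ.2.1
    · simp only [RamInstr.run, hv]
      exact hρ.1.setValue _
  refine (terminates_nestProg hs hA hB (2 * (s * p)) le_rfl hτ).seq fun τ hτ => ?_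
  obtain ⟨δ', δb', h1, h2, -, h4⟩ := hτ
  refine (terminates_restoreProg h1).seq fun τ hτ => ?_
  obtain ⟨δ, g1, g2⟩ := hτ
  refine (terminates_evalProg hs hA hB g1).mono le_rfl fun ρ hρ => ⟨δ, hρ.2.2.2, fun ε hε => ?_⟩
  rw [value_candidate_congr g2]
  -- The enumeration leaves digits beyond `2 * (s * p)` at zero; `ε` is truncated accordingly, which
  -- does not affect its candidate.
  have e : ∀ u < 2 * (s * p), ε u = if u < 2 * (s * p) then ε u else 0 :=
    fun u hu => (if_pos hu).symm
  rw [value_candidate_congr e]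
  refine h4 _ (fun u hu => if_neg (not_lt.2 hu)) fun u hu => ?_
  simp only [if_pos hu]
  exact hε u hu

/-! ### Optimality -/

theorem value_eq_sum (x : ℕ → ℕ → ℚ) {j : ℕ} (hj : j < s) :
    value s p σ₀ x = ∑ i ∈ Finset.range p,
      (∏ j' ∈ (Finset.range s).erase j, factor s σ₀ (i * s + j') (x j') (σ₀.reg j'))
        * factor s σ₀ (i * s + j) (x j) (σ₀.reg j) :=
  Finset.sum_congr rfl fun _ _ => (Finset.prod_erase_mul _ _ (Finset.mem_range.2 hj)).symm

theorem sum_mul_factor (w y : ℕ → ℚ) (j n : ℕ) :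
    ∑ i ∈ Finset.range p, w i * factor s σ₀ (i * s + j) y n
      = ∑ i ∈ Finset.range p, w i * factor s σ₀ (i * s + j) y 0
        + ∑ k ∈ Finset.range n, (∑ i ∈ Finset.range p, w i * σ₀.arr (i * s + j) k) * y k := by
  simp only [Finset.sum_mul]
  rw [Finset.sum_comm, ← Finset.sum_add_distrib]
  refine Finset.sum_congr rfl fun i _ => ?_
  simp only [factor, Finset.range_zero, Finset.sum_empty, add_zero, mul_add, Finset.mul_sum,
    mul_assoc]

/-- With the other blocks frozen the value is affine in block `j`, and on the cube each coordinate
is best set to `1` exactly when its coefficient is positive. -/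
theorem value_le_of_sign {x y : ℕ → ℕ → ℚ} {j : ℕ} (hj : j < s)
    (hxy : ∀ j' < s, j' ≠ j → x j' = y j') (hx : ∀ k, x j k = 0 ∨ x j k = 1)
    (hy : ∀ k < σ₀.reg j, y j k = if 0 < ∑ i ∈ Finset.range p,
      (∏ j' ∈ (Finset.range s).erase j, factor s σ₀ (i * s + j') (x j') (σ₀.reg j'))
        * σ₀.arr (i * s + j) k then 1 else 0) :
    value s p σ₀ x ≤ value s p σ₀ y := by
  rw [value_eq_sum x hj, value_eq_sum y hj]
  have hw : ∀ i, (∏ j' ∈ (Finset.range s).erase j, factor s σ₀ (i * s + j') (y j') (σ₀.reg j'))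
      = ∏ j' ∈ (Finset.range s).erase j, factor s σ₀ (i * s + j') (x j') (σ₀.reg j') :=
    fun i => Finset.prod_congr rfl fun j' hj' => by
      rw [Finset.mem_erase, Finset.mem_range] at hj'
      rw [hxy j' hj'.2 hj'.1]
  simp only [hw]
  rw [sum_mul_factor, sum_mul_factor _ (y j)]
  refine add_le_add (le_of_eq (Finset.sum_congr rfl fun i _ => by simp [factor]))
    (Finset.sum_le_sum fun k hk => ?_)
  rw [hy k (Finset.mem_range.1 hk)]
  split_ifs with h <;> rcases hx k with h' | h' <;> rw [h'] <;> linarith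

/-- Blocks are replaced one at a time, each with weights from the current, partly replaced point, so
the value never decreases. -/
theorem exists_digits (hs : ∀ j < s, 0 < σ₀.reg j) {x : ℕ → ℕ → ℚ}
    (hx : ∀ j k, x j k = 0 ∨ x j k = 1) :
    ∃ δ : ℕ → ℕ, (∀ u < 2 * (s * p), δ u < digitBound p σ₀ u) ∧
      value s p σ₀ x ≤ value s p σ₀ (candidate s p σ₀ δ) := by
  have main : ∀ J ≤ s, ∃ δ : ℕ → ℕ, (∀ u < 2 * (s * p), δ u < digitBound p σ₀ u) ∧
      value s p σ₀ x ≤ value s p σ₀ fun j => if j < J then candidate s p σ₀ δ j else x j := by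
    intro J
    induction J with
    | zero =>
      refine fun _ => ⟨fun _ => 0, fun u hu => ?_, by simp⟩
      unfold digitBound
      split_ifs
      exacts [hs _ (div_div_lt hu), three_pos]
    | succ J ih =>
      intro hJ
      obtain ⟨δ, h1, h2⟩ := ih (by omega)
      set y : ℕ → ℕ → ℚ := fun j => if j < J then candidate s p σ₀ δ j else x j with hy
      obtain ⟨k, τ, hk, hτ, hpat⟩ := exists_pattern (fun l i => σ₀.arr (i * s + J) l)
        (fun i => ∏ j' ∈ (Finset.range s).erase J, factor s σ₀ (i * s + j') (y j') (σ₀.reg j'))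
        (hs J hJ) p
      have hsgn : ∀ m, ∃ d < 3, signs d = τ m := fun m => by
        rcases hτ m with h | h | h
        · exact ⟨0, by norm_num, by simp [signs, Function.update, h]⟩
        · exact ⟨1, by norm_num, by simp [signs, Function.update, h]⟩
        · exact ⟨2, by norm_num, by simp [signs, h]⟩
      choose d hd1 hd2 using hsgn
      -- Digit `2 * (j * p + m)` is the `m`-th pivot of block `j` and its successor the sign; only
      -- the digits of block `J` are overwritten.
      let δ' : ℕ → ℕ := fun u =>
        if u / 2 / p = J then (if u % 2 = 0 then k (u / 2 % p) else d (u / 2 % p)) else δ u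
      have hidx : ∀ j, ∀ m < p, (j * p + m) / p = j ∧ (j * p + m) % p = m := fun j m hm => by
        rw [mul_comm j p]
        exact ⟨by rw [Nat.mul_add_div (by omega), Nat.div_eq_of_lt hm, add_zero],
          by rw [Nat.mul_add_mod, Nat.mod_eq_of_lt hm]⟩
      have he : ∀ n : ℕ, 2 * n / 2 = n ∧ 2 * n % 2 = 0 ∧ (2 * n + 1) / 2 = n ∧
        (2 * n + 1) % 2 ≠ 0 := fun n => by omega
      have hne : ∀ j, j ≠ J → candidate s p σ₀ δ' j = candidate s p σ₀ δ j := by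
        intro j hj
        funext l
        unfold candidate
        rw [pattern_congr (k' := fun m => δ (2 * (j * p + m)))
          (τ' := fun m => signs (δ (2 * (j * p + m) + 1)))]
        · intro m hm
          simp only [δ', (he _).1, (hidx j m hm).1, if_neg hj]
        · intro m hm
          simp only [δ', (he _).2.2.1, (hidx j m hm).1, if_neg hj]
      have hJc : ∀ l, candidate s p σ₀ δ' J l
          = if 0 < pattern (fun l i => σ₀.arr (i * s + J) l) k τ p l then 1 else 0 := by
        intro l
        unfold candidate
        rw [pattern_congr (k' := k) (τ' := τ)]
        · intro m hm
          simp only [δ', (he _).1, (he _).2.1, (hidx J m hm).1, (hidx J m hm).2, if_true]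
        · intro m hm
          simp only [δ', (he _).2.2.1, (he _).2.2.2, (hidx J m hm).1, (hidx J m hm).2, if_true,
            if_false, hd2]
      refine ⟨δ', fun u hu => ?_, h2.trans (value_le_of_sign (j := J) hJ ?_ ?_ ?_)⟩
      · simp only [δ']
        split_ifs with e1 e2
        · simp only [digitBound, e1, e2, if_true]
          exact hk _
        · simp only [digitBound, e2, if_false]
          exact hd1 _
        · exact h1 u hu
      · intro j _ hj
        simp only [hy]
        rw [hne j hj]
        have : j < J ↔ j < J + 1 := by omega
        simp only [this]
      · intro l
        simpa [hy] using hx J l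
      · intro l hl
        have h3 := hpat l hl
        simp only [Nat.lt_succ_self, if_true, hJc]
        have h4 : ∀ q : ℚ, 0 < q ↔ SignType.sign q = 1 := fun q => sign_eq_one_iff.symm
        exact if_congr (by rw [h4, h3, ← h4]) rfl rfl
  obtain ⟨δ, h1, h2⟩ := main s le_rfl
  refine ⟨δ, h1, h2.trans (le_of_eq (value_congr fun j hj k _ => ?_))⟩
  simp only [if_pos hj]

end AffineFBPO

/-! ### Polynomial bounds for the running time -/

/-- Functions with a polynomial upper bound. -/
def PolyBounded (f : ℕ → ℕ) : Prop :=
  ∃ P : Polynomial ℕ, ∀ n, f n ≤ P.eval n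

namespace PolyBounded

theorem const (c : ℕ) : PolyBounded fun _ => c :=
  ⟨Polynomial.C c, fun n => by simp⟩

theorem id : PolyBounded fun n => n :=
  ⟨Polynomial.X, fun n => by simp⟩

theorem add {f g : ℕ → ℕ} (hf : PolyBounded f) (hg : PolyBounded g) :
    PolyBounded fun n => f n + g n := by
  obtain ⟨P, hP⟩ := hf
  obtain ⟨Q, hQ⟩ := hg
  exact ⟨P + Q, fun n => by simpa using add_le_add (hP n) (hQ n)⟩

theorem mul {f g : ℕ → ℕ} (hf : PolyBounded f) (hg : PolyBounded g) :
    PolyBounded fun n => f n * g n := by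
  obtain ⟨P, hP⟩ := hf
  obtain ⟨Q, hQ⟩ := hg
  exact ⟨P * Q, fun n => by simpa using Nat.mul_le_mul (hP n) (hQ n)⟩

end PolyBounded

namespace AffineFBPO

theorem polyBounded_evalTime (s p : ℕ) : PolyBounded (evalTime s p) :=
  (((PolyBounded.const _).mul ((PolyBounded.id.mul (.const _)).add (.const 6))).add
    (.const _)).add (.const 3)

/-- Each loop multiplies the time by about `N + 3`, and the depth does not depend on `N`. -/
theorem polyBounded_nestTime (s p v : ℕ) : PolyBounded fun N => nestTime s p N v := by
  induction v with
  | zero => exact (polyBounded_evalTime s p).add (.const _)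
  | succ v ih => exact ((PolyBounded.id.add (.const 3)).mul (ih.add (.const 2))).add (.const 2)

theorem polyBounded_mainTime (s p : ℕ) : PolyBounded (mainTime s p) :=
  (PolyBounded.const 5).add (((polyBounded_evalTime s p).add (.const 1)).add
    ((polyBounded_nestTime s p _).add ((PolyBounded.const _).add (polyBounded_evalTime s p))))

variable {s p : ℕ} (A : AffineFBPO s p)

/-! ### The input -/

theorem input_reg {j : ℕ} (hj : j < s) : A.input.reg j = A.n ⟨j, hj⟩ :=
  dif_pos hj

theorem input_reg_of_le {r : ℕ} (hr : s ≤ r) : A.input.reg r = 0 :=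
  dif_neg (not_lt.2 hr)

theorem input_iarr_le (i j : ℕ) : A.input.iarr i j ≤ 1 := by
  simp only [input]
  split_ifs <;> simp

theorem mul_add_div_mod {i j : ℕ} (hj : j < s) : (i * s + j) / s = i ∧ (i * s + j) % s = j :=
  ⟨by rw [mul_comm, Nat.mul_add_div (by omega), Nat.div_eq_of_lt hj, add_zero],
    Nat.mul_add_mod_of_lt hj⟩

theorem input_iarr_pos_iff (i : Fin p) (j : Fin s) : 0 < A.input.iarr i j ↔ j ∈ A.fam i := by
  simp only [input, Fin.is_lt, exists_true_left, Fin.eta]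
  split_ifs with h <;> simp [h]

theorem input_arr_of_mem {i : Fin p} {j : Fin s} (h : j ∈ A.fam i) (k : ℕ) :
    A.input.arr (i * s + j) k = if hk : k < A.n j then A.c i ⟨j, h⟩ ⟨k, hk⟩
      else if k = A.n j then A.d i ⟨j, h⟩ else 0 := by
  -- Quotient and remainder become variables, because the types of the coefficients depend on them.
  have key : ∀ a b : ℕ, a = i → b = j → (if h : ∃ (hi : a < p) (hj : b < s),
      (⟨b, hj⟩ : Fin s) ∈ A.fam ⟨a, hi⟩ then
      if hk : k < A.n ⟨b, h.2.1⟩ then A.c ⟨a, h.1⟩ ⟨⟨b, h.2.1⟩, h.2.2⟩ ⟨k, hk⟩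
      else if k = A.n ⟨b, h.2.1⟩ then A.d ⟨a, h.1⟩ ⟨⟨b, h.2.1⟩, h.2.2⟩
      else 0
    else 0) = if hk : k < A.n j then A.c i ⟨j, h⟩ ⟨k, hk⟩
      else if k = A.n j then A.d i ⟨j, h⟩ else 0 := by
    rintro _ _ rfl rfl
    exact dif_pos ⟨i.2, j.2, h⟩
  obtain ⟨h1, h2⟩ := mul_add_div_mod (i := i) j.2
  exact key _ _ h1 h2

theorem input_arr_of_notMem {i : Fin p} {j : Fin s} (h : j ∉ A.fam i) (k : ℕ) :
    A.input.arr (i * s + j) k = 0 := by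
  refine dif_neg ?_
  obtain ⟨h1, h2⟩ := mul_add_div_mod (i := i) j.2
  rintro ⟨hi, hj, hm⟩
  have e1 : (⟨(i * s + j) / s, hi⟩ : Fin p) = i := Fin.ext h1
  have e2 : (⟨(i * s + j) % s, hj⟩ : Fin s) = j := Fin.ext h2
  rw [e1, e2] at hm
  exact h hm

theorem input_arr_of_le {a : ℕ} (ha : p * s ≤ a) (k : ℕ) : A.input.arr a k = 0 := by
  refine dif_neg ?_
  rintro ⟨hi, hj, -⟩
  exact absurd ha (not_le.2 ((Nat.div_lt_iff_lt_mul (by omega)).1 hi))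

theorem input_factor (i : Fin p) (j : Fin s) (x : ℕ → ℚ) (l : ℕ) :
    factor s A.input (i * s + j) x l
      = (if h : j ∈ A.fam i then A.d i ⟨j, h⟩ else 1)
        + ∑ k ∈ Finset.range l, A.input.arr (i * s + j) k * x k := by
  obtain ⟨h1, h2⟩ := mul_add_div_mod (i := i) j.2
  simp only [factor, h1, h2, input_iarr_pos_iff]
  congr 1
  split_ifs with h
  · rw [A.input_arr_of_mem h, A.input_reg j.2]
    simp
  · rfl

/-! ### Sizes -/

theorem n_le_dim (j : Fin s) : A.n j ≤ A.dim :=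
  (Finset.single_le_sum (f := A.n) (fun _ _ => Nat.zero_le _) (Finset.mem_univ j)).trans
    (Nat.le_add_right _ _)

theorem sum_ratSize_le {i : Fin p} {j : Fin s} (h : j ∈ A.fam i) :
    A.n j + ((∑ k, ratSize (A.c i ⟨j, h⟩ k)) + ratSize (A.d i ⟨j, h⟩)) ≤ A.size := by
  have h1 := A.n_le_dim j
  have h2 := Finset.single_le_sum (f := fun j : A.fam i =>
    (∑ k : Fin (A.n j), ratSize (A.c i j k)) + ratSize (A.d i j))
    (fun _ _ => Nat.zero_le _) (Finset.mem_univ ⟨j, h⟩)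
  have h3 := Finset.single_le_sum (f := fun i : Fin p => ∑ j : A.fam i,
    ((∑ k : Fin (A.n j), ratSize (A.c i j k)) + ratSize (A.d i j)))
    (fun _ _ => Nat.zero_le _) (Finset.mem_univ i)
  exact add_le_add h1 (h2.trans h3)

theorem exists_eq_mul_add {u : ℕ} (hu : u < p * s) : ∃ (i : Fin p) (j : Fin s), u = i * s + j := by
  have hs : 0 < s := Nat.pos_of_ne_zero fun h => by simp [h] at hu
  exact ⟨⟨u / s, (Nat.div_lt_iff_lt_mul hs).2 hu⟩, ⟨u % s, Nat.mod_lt _ hs⟩,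
    (Nat.div_add_mod' u s).symm⟩

theorem ratBound_input (a k : ℕ) : RatBound A.size (A.input.arr a k) := by
  rcases Nat.lt_or_ge a (p * s) with ha | ha
  · obtain ⟨i, j, rfl⟩ := exists_eq_mul_add ha
    by_cases h : j ∈ A.fam i
    · have h1 := A.sum_ratSize_le h
      rw [A.input_arr_of_mem h]
      split_ifs with hk hk'
      · have h2 := Finset.single_le_sum (f := fun k => ratSize (A.c i ⟨j, h⟩ k))
          (fun _ _ => Nat.zero_le _) (Finset.mem_univ ⟨k, hk⟩)
        exact (ratBound_ratSize _).mono (h2.trans (by omega))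
      · exact (ratBound_ratSize _).mono (by omega)
      · exact ratBound_zero _
    · rw [A.input_arr_of_notMem h]
      exact ratBound_zero _
  · rw [A.input_arr_of_le ha]
    exact ratBound_zero _

/-- The extra bit per addition is paid for by the dimension, which is part of `size`. -/
theorem ratBound_factor {u : ℕ} (hu : u < p * s) {x : ℕ → ℚ} (hx : ∀ k, x k = 0 ∨ x k = 1) {l : ℕ}
    (hl : l ≤ A.input.reg (u % s)) : RatBound A.size (factor s A.input u x l) := by
  obtain ⟨i, j, rfl⟩ := exists_eq_mul_add hu
  rw [(mul_add_div_mod j.2).2, A.input_reg j.2] at hl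
  rw [A.input_factor]
  by_cases h : j ∈ A.fam i
  · rw [dif_pos h]
    let r : ℕ → ℕ := fun k => if hk : k < A.n j then ratSize (A.c i ⟨j, h⟩ ⟨k, hk⟩) else 0
    refine (ratBound_sum (Finset.range l) _ r (ratBound_ratSize (A.d i ⟨j, h⟩))
      fun k hk => ?_).mono ?_
    · have hk' : k < A.n j := (Finset.mem_range.1 hk).trans_le hl
      rw [A.input_arr_of_mem h, dif_pos hk']
      simp only [r, dif_pos hk']
      rcases hx k with h0 | h0 <;> rw [h0]
      · rw [mul_zero]
        exact ratBound_zero _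
      · rw [mul_one]
        exact ratBound_ratSize _
    · have h1 := A.sum_ratSize_le h
      have h2 : ∑ k ∈ Finset.range l, (r k + 1) ≤ ∑ k ∈ Finset.range (A.n j), (r k + 1) :=
        Finset.sum_le_sum_of_subset (Finset.range_mono hl)
      have h3 : ∑ k ∈ Finset.range (A.n j), r k = ∑ k, ratSize (A.c i ⟨j, h⟩ k) := by
        rw [Finset.sum_range]
        exact Finset.sum_congr rfl fun k _ => by simp [r]
      rw [Finset.sum_add_distrib, Finset.sum_add_distrib] at h2
      rw [Finset.sum_add_distrib]
      simp only [Finset.sum_const, Finset.card_range, smul_eq_mul, mul_one] at h2 ⊢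
      omega
  · simp only [dif_neg h, A.input_arr_of_notMem h, zero_mul, Finset.sum_const_zero, add_zero]
    exact ratBound_one _

theorem admissible {W : ℕ} (hW : A.dim + s + 3 ≤ W) :
    Admissible s p A.dim W A.size A.input where
  dim_le j hj := by
    rw [A.input_reg hj]
    exact A.n_le_dim _
  le := hW
  iarr_le := A.input_iarr_le
  arr := A.ratBound_input
  factor _ hu _ hx _ hl := A.ratBound_factor hu hx hl

/-- A block outside a member contributes the factor one, so the products may run over all blocks. -/
theorem objective_eq_value {x : (j : Fin s) → Fin (A.n j) → ℚ} {y : ℕ → ℕ → ℚ}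
    (hxy : ∀ j k, x j k = y j k) : A.objective x = value s p A.input y := by
  unfold objective value
  rw [Finset.sum_range]
  refine Finset.sum_congr rfl fun i _ => ?_
  rw [Finset.prod_range]
  have h0 : ∀ j ∈ Finset.univ, j ∉ A.fam i →
      factor s A.input (i * s + j) (y j) (A.input.reg j) = 1 := fun j _ h => by
    simp [A.input_factor, h, A.input_arr_of_notMem h]
  rw [← Finset.prod_subset (Finset.subset_univ (A.fam i)) h0, 
    ← Finset.prod_coe_sort (A.fam i) fun j =>
      factor s A.input (i * s + j) (y j) (A.input.reg j)]
  refine Finset.prod_congr rfl fun j _ => ?_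
  rw [A.input_factor, dif_pos j.2, add_comm, A.input_reg j.1.2, Finset.sum_range]
  congr 1
  refine Finset.sum_congr rfl fun k _ => ?_
  rw [A.input_arr_of_mem j.2, dif_pos k.2, hxy]

end AffineFBPO

/-! ### The main theorem -/

theorem mainTheorem6 (s p : ℕ) (hs : 0 < s) (hp : 0 < p) :
    StronglyPolynomial (ι := AffineFBPO s p) AffineFBPO.dim AffineFBPO.size AffineFBPO.input
      (fun A τ => A.IsOptimal (A.output τ)) := by
  -- The added `N + s + 3` lets `T` also bound the control integers.
  obtain ⟨T, hT⟩ := ((AffineFBPO.polyBounded_mainTime s p).add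
    ((PolyBounded.id.add (.const s)).add (.const 3)))
  refine ⟨AffineFBPO.mainProg s p, T,
    2 * (Polynomial.C (AffineFBPO.maxWeight s p) * (Polynomial.X + 1)) + 3, fun A => ?_⟩
  have hTA : AffineFBPO.mainTime s p A.dim + (A.dim + s + 3) ≤ T.eval A.dim := hT A.dim
  obtain ⟨t, τ, h1, h2, δ, h3, h4⟩ := AffineFBPO.terminates_mainProg
    (W := T.eval A.dim)
    (B := (2 * (Polynomial.C (AffineFBPO.maxWeight s p) * (Polynomial.X + 1)) + 3 :
      Polynomial ℕ).eval A.size) hs (A.admissible (by omega)) (by simp)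
    (fun r hr => A.input_reg_of_le hr) (fun a k ha => A.input_arr_of_le ha k)
  refine ⟨t, τ, h1, by omega, ?_⟩
  have hout : ∀ j k, A.output τ j k = AffineFBPO.candidate s p A.input δ j k := fun j k =>
    h3 j j.2 k (by rw [A.input_reg j.2]; exact k.2)
  refine ⟨fun j k => ?_, fun x hx => ?_⟩
  · rw [hout]
    exact AffineFBPO.candidate_eq _ _ _ _ _ _
  · let y : ℕ → ℕ → ℚ := fun j k =>
      if hj : j < s then if hk : k < A.n ⟨j, hj⟩ then x ⟨j, hj⟩ ⟨k, hk⟩ else 0 else 0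
    have hy : ∀ j k, y j k = 0 ∨ y j k = 1 := fun j k => by
      simp only [y]
      split_ifs
      exacts [hx _ _, Or.inl rfl, Or.inl rfl]
    obtain ⟨ε, hε, hle⟩ := AffineFBPO.exists_digits (p := p) (σ₀ := A.input)
      (fun j hj => by rw [A.input_reg hj]; exact A.n_pos _) hy
    show A.objective x ≤ A.objective (A.output τ)
    rw [A.objective_eq_value hout, A.objective_eq_value (y := y) fun j k => by simp [y]]
    exact hle.trans (h4 ε hε)
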